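/- Let $F$ be a finite field with $q$ elements and consider one of the following three independent cases, in each of which $V$ is a finite-dimensional $F$-vector space with a nondegenerate form $\langle\cdot,\cdot\rangle\colon V\times V\to F$. * (uH) $F/F_0$ is a quadratic extension, $q_0=\#F_0$ (so $q=q_0^2$), and the form is $F/F_0$-Hermitian. Put $\gamma=1$, $\mathrm{Sign}=\{1\}$. * (S) $q$ is odd and the form is symmetric. Put $\gamma=1$, $\mathrm{Sign}=F^\times/(F^\times)^2=\{\pm1\}$. * (A) The form is alternating. Put $\gamma=2$, $\mathrm{Sign}=\{1\}$. Let $\mathrm{sign}\colon F^\times\to\mathrm{Sign}$ be the natural map (the quadratic character in case (S), trivial in the other cases) and $\epsilon=\mathrm{sign}(-1)$. The type of a nondegenerate space $W$ is $\mathrm{typ}(W)=(d,\chi)$, where $d=\frac1\gamma\dim_F W$ and $\chi\in\mathrm{Sign}$ is the sign of the Gram determinant of the form in any basis of $W$. (In cases (uH) and (A) always $\chi=1$.) For $n\ge 0$ write $(n)_x=\prod_{i=1}^n(x^i-1)$, and in case (S) put $e(r,\chi)=q^{r/2}+\epsilon^{r/2}\chi$ if $r$ is even and $e(r,\chi)=1$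 if $r$ is odd. **Theorem.** Let $\mathrm{typ}(V)=(r,\chi)$. Let $0\le m,n\le r$ be integers and $\psi_1\in\mathrm{Sign}$, and put $$l=r-n-\tfrac{2}{\gamma}m,\qquad \psi_2=\chi\,\psi_1\,\epsilon^m .$$ Then the number of subspaces $N\subseteq V$ such that $\dim(N\cap N^\perp)=m$ and $N/(N\cap N^\perp)$, with the induced form, has type $(n,\psi_1)$ is equal to $0$ if $l<0$, and if $l\ge0$ it is equal to $$Q(n,\psi_1,m,l,\psi_2)=\begin{cases} \displaystyle(-1)^m(-q_0)^{nl}\,\frac{(r)_{-q_0}}{(n)_{-q_0}\,(m)_{q_0^2}\,(l)_{-q_0}} & \text{in case (uH)},\\[3mm] \displaystyle\frac{q^{\lfloor nl/2\rfloor}}{2}\,\frac{(\lfloor r/2\rfloor)_{q^2}}{(\lfloor n/2\rfloor)_{q^2}\,(m)_{q}\,(\lfloor l/2\rfloor)_{q^2}}\cdot\frac{e(n,\psi_1)\,e(l,\psi_2)}{e(r,\chi)} & \text{in case (S)},\\[3mm] \displaystyle q^{2nl}\,\frac{(r)_{q^2}}{(n)_{q^2}\,(m)_{q}\,(l)_{q^2}}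 & \text{in case (A)}. \end{cases}$$ -/

import Mathlib

/-- The three (independent) cases: Hermitian, symmetric and alternating forms. -/
inductive FormCase : Type
  | hermitian
  | symmetric
  | alternating

namespace FormCase

/-- The normalising constant `γ`: `2` in the alternating case and `1` otherwise. -/
def gamma : FormCase → ℕ
  | hermitian => 1
  | symmetric => 1
  | alternating => 2

/-- The set of signs: `{1, -1}` in the symmetric case and `{1}` otherwise. -/
def Sign : FormCase → Set ℤ
  | hermitian => {1}
  | symmetric => {1, -1}
  | alternating => {1}

/-- The sign of a nonzero element `a` of the finite field `F`: in the symmetric case the class of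
`a` in `Fˣ / (Fˣ)² = {1, -1}`, and `1` in the other cases. -/
def sign (F : Type*) [Field F] [Fintype F] [DecidableEq F] (c : FormCase) (a : F) : ℤ :=
  match c with
  | hermitian => 1
  | symmetric => quadraticChar F a
  | alternating => 1

/-- The condition that `B` is a form of the given kind on an `F`-vector space `V`, where `σ` is the
automorphism of `F` for which `B` is sesquilinear:
* Hermitian: `F / F₀` is quadratic, `σ` is its nontrivial automorphism and `B` is `F/F₀`-Hermitian;
* symmetric: `F = F₀` has odd characteristic, `σ` is trivial and `B` is symmetric;
* alternating: `F = F₀`, `σ` is trivial and `B` is alternating. -/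
def IsForm (F₀ : Type*) {F V : Type*} [Field F₀] [Field F] [Algebra F₀ F]
    [AddCommGroup V] [Module F V] (c : FormCase) (σ : F →+* F)
    (B : V →ₛₗ[σ] V →ₗ[F] F) : Prop :=
  match c with
  | hermitian => Module.finrank F₀ F = 2 ∧ (∀ a : F₀, σ (algebraMap F₀ F a) = algebraMap F₀ F a) ∧
      σ ≠ RingHom.id F ∧ ∀ x y, σ (B x y) = B y x
  | symmetric => Module.finrank F₀ F = 1 ∧ ringChar F ≠ 2 ∧ σ = RingHom.id F ∧
      ∀ x y, B x y = B y x
  | alternating => Module.finrank F₀ F = 1 ∧ σ = RingHom.id F ∧ ∀ x, B x x = 0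

theorem IsForm.isRefl {F₀ F V : Type*} [Field F₀] [Field F] [Algebra F₀ F]
    [AddCommGroup V] [Module F V] {c : FormCase} {σ : F →+* F}
    {B : V →ₛₗ[σ] V →ₗ[F] F} (hB : c.IsForm F₀ σ B) : B.IsRefl := by
  cases c with
  | hermitian =>
    intro x y h
    rw [← hB.2.2.2 x y, h, map_zero]
  | symmetric =>
    intro x y h
    rw [← hB.2.2.2 x y, h]
  | alternating =>
    obtain ⟨-, rfl, h⟩ := hB
    exact LinearMap.IsAlt.isRefl h

/-- The space `(V, B)` is nondegenerate of type `(d, χ)`: the dimension of `V` is `γ d` and the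
Gram determinant of `B` in a basis has sign `χ`. (The sign does not depend on the basis, see
`sign_det_gram_eq`.) -/
def HasType {F V : Type*} [Field F] [Fintype F] [DecidableEq F] [AddCommGroup V] [Module F V]
    (c : FormCase) {σ : F →+* F} (B : V →ₛₗ[σ] V →ₗ[F] F) (d : ℕ) (χ : ℤ) : Prop :=
  B.Nondegenerate ∧ ∃ b : Module.Basis (Fin (c.gamma * d)) F V,
    c.sign F (Matrix.det (Matrix.of fun i j => B (b i) (b j))) = χ

theorem sign_det_gram_eq {F₀ F V : Type*} [Field F₀] [Field F] [Algebra F₀ F]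
    [Fintype F] [DecidableEq F] [AddCommGroup V] [Module F V] {c : FormCase} {σ : F →+* F}
    {B : V →ₛₗ[σ] V →ₗ[F] F} (hB : c.IsForm F₀ σ B) {n : ℕ} (b b' : Module.Basis (Fin n) F V) :
    c.sign F (Matrix.det (Matrix.of fun i j => B (b i) (b j))) =
      c.sign F (Matrix.det (Matrix.of fun i j => B (b' i) (b' j))) := by
  cases c with
  | hermitian => rfl
  | alternating => rfl
  | symmetric =>
    obtain ⟨-, -, rfl, -⟩ := hB
    have h1 : ∀ b : Module.Basis (Fin n) F V,
        (Matrix.of fun i j => B (b i) (b j)) = LinearMap.BilinForm.toMatrix b B := by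
      intro b
      ext i j
      rw [LinearMap.BilinForm.toMatrix_apply, Matrix.of_apply]
    have h2 := LinearMap.BilinForm.toMatrix_mul_basis_toMatrix b b' B
    have h3 : (b.toMatrix b').det ≠ 0 := by
      have := congrArg Matrix.det (b.toMatrix_mul_toMatrix_flip b')
      rw [Matrix.det_mul, Matrix.det_one] at this
      exact left_ne_zero_of_mul_eq_one this
    rw [h1 b, h1 b', ← h2]
    simp only [sign, Matrix.det_mul, Matrix.det_transpose, map_mul]
    have h4 := quadraticChar_sq_one h3
    linear_combination (-(quadraticChar F (LinearMap.BilinForm.toMatrix b B).det)) * h4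

end FormCase

/-- The radical `N ∩ N^⊥` of a subspace `N`, as a subspace of `V`. -/
def formRadical {F V : Type*} [Field F] [AddCommGroup V] [Module F V] {σ : F →+* F}
    (B : V →ₛₗ[σ] V →ₗ[F] F) (N : Submodule F V) : Submodule F V :=
  N ⊓ N.orthogonalBilin B

theorem formRadical_le_ker {F V : Type*} [Field F] [AddCommGroup V] [Module F V] {σ : F →+* F}
    {B : V →ₛₗ[σ] V →ₗ[F] F} (hB : B.IsRefl) (N : Submodule F V) :
    (formRadical B N).submoduleOf N ≤ LinearMap.ker (B.domRestrict₁₂ N N) := by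
  intro x hx
  rw [LinearMap.mem_ker]
  ext y
  exact hB _ _ (hx.2 y y.2)

/-- The form induced by `B` on the quotient `N / (N ∩ N^⊥)`. -/
def quotientForm {F V : Type*} [Field F] [AddCommGroup V] [Module F V] {σ : F →+* F}
    (B : V →ₛₗ[σ] V →ₗ[F] F) (hB : B.IsRefl) (N : Submodule F V) :
    (↥N ⧸ (formRadical B N).submoduleOf N) →ₛₗ[σ]
      (↥N ⧸ (formRadical B N).submoduleOf N) →ₗ[F] F :=
  LinearMap.IsRefl.liftQ₂ (B.domRestrict₁₂ N N) ((formRadical B N).submoduleOf N)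
    (hB.domRestrict N) (formRadical_le_ker hB N)

theorem quotientForm_mk {F V : Type*} [Field F] [AddCommGroup V] [Module F V] {σ : F →+* F}
    (B : V →ₛₗ[σ] V →ₗ[F] F) (hB : B.IsRefl) (N : Submodule F V) (x y : ↥N) :
    quotientForm B hB N (Submodule.Quotient.mk x) (Submodule.Quotient.mk y) = B x y :=
  rfl

/-- The falling factorial `(n)_x = ∏_{i=1}^n (x^i - 1)`. -/
def qFalling (x : ℚ) (n : ℕ) : ℚ := ∏ i ∈ Finset.Icc 1 n, (x ^ i - 1)

/-- `e(r, χ) = q^{r/2} + ε^{r/2} χ` for `r` even and `e(r, χ) = 1` for `r` odd. -/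
def eFactor (q : ℕ) (ε : ℤ) (r : ℕ) (χ : ℤ) : ℚ :=
  if Even r then (q : ℚ) ^ (r / 2) + (ε : ℚ) ^ (r / 2) * χ else 1

/-- The explicit expression `Q(n, ψ₁, m, l, ψ₂)`, where `r = n + (2 / γ) m + l`, `χ = ψ₁ ε^m ψ₂`, `q₀ = #F₀`,
`q = #F` and `ε = sign (-1)`; it is `0` if `l` is negative. -/
def formulaQ (c : FormCase) (q₀ q : ℕ) (ε : ℤ) (r : ℕ) (χ : ℤ)
    (n : ℕ) (ψ₁ : ℤ) (m : ℕ) (l : ℤ) (ψ₂ : ℤ) : ℚ :=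
  if l < 0 then 0 else
    match c with
    | FormCase.hermitian =>
        (-1) ^ m * (-(q₀ : ℚ)) ^ (n * l.toNat) *
          (qFalling (-(q₀ : ℚ)) r /
            (qFalling (-(q₀ : ℚ)) n * qFalling ((q₀ : ℚ) ^ 2) m * qFalling (-(q₀ : ℚ)) l.toNat))
    | FormCase.symmetric =>
        (q : ℚ) ^ (n * l.toNat / 2) / 2 *
          (qFalling ((q : ℚ) ^ 2) (r / 2) /
            (qFalling ((q : ℚ) ^ 2) (n / 2) * qFalling (q : ℚ) m *
              qFalling ((q : ℚ) ^ 2) (l.toNat / 2))) *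
          (eFactor q ε n ψ₁ * eFactor q ε l.toNat ψ₂ / eFactor q ε r χ)
    | FormCase.alternating =>
        (q : ℚ) ^ (2 * n * l.toNat) *
          (qFalling ((q : ℚ) ^ 2) r /
            (qFalling ((q : ℚ) ^ 2) n * qFalling (q : ℚ) m * qFalling ((q : ℚ) ^ 2) l.toNat))

/-! With Witt's theorem the answer would be an orbit length, the order of the isometry group of V
divided by the order of the stabilizer of N. The proof reaches the same quotient by double counting
and never forms an isometry group: `isomOrder` is only a rational number that records the known
orders.

Fix an invertible matrix G of size γn whose determinant has sign ψ₁. A mixed frame is a family e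
with Gram matrix G together with m independent, mutually orthogonal isotropic vectors u in e^⊥. Its
span N has radical ⟨u⟩ and quotient of type (n, ψ₁) (`MixedFrames.formRadical_span`,
`hasType_quotient_span`). Conversely, a mixed frame spanning a given N amounts to a basis of the
radical, a G-frame of the quotient and a lift of it to N (`card_mixedFrames_span_eq`,
`card_gramFrames_quotient`). There are |Isom(n, ψ₁)| · q^(mγn) · |GL_m(F)| of these, whatever N is.
Counted the other way, V has |Isom(V)| / |Isom(e^⊥)| frames e (`exists_wittCount`), and e^⊥ contains
a similar ratio, divided by a power of the field size, of isotropic m-frames (`card_isoFrames`).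
Dividing gives Q up to algebra (`formulaQ_hermitian_mul`, `formulaQ_symmetric_mul`,
`formulaQ_alternating_mul`).

Both frame counts are telescoping products, obtained by splitting off one vector or one plane at a
time. They rest on the number of vectors of given norm, found by induction on the dimension after
splitting off an anisotropic vector (`card_mul_normCount_symmetric`,
`card_mul_normCount_hermitian`); for alternating forms every vector is isotropic.

In the symmetric case no space has type (0, -1). There `eFactor` is 0, so `isomOrder` and its
inverse are 0 as well, and the ratios correctly give 0 whenever a complement would have that type.
-/

/-! ### Families with a prescribed Gram matrix and their orthogonal complements. -/

section Frames

variable {F V : Type*} [Field F] [AddCommGroup V] [Module F V] {σ : F →+* F}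
  {ι κ : Type*}

/-- The families of vectors with Gram matrix `G`. -/
def gramFrames (B : V →ₛₗ[σ] V →ₗ[F] F) (G : Matrix ι ι F) : Set (ι → V) :=
  {e | ∀ i j, B (e i) (e j) = G i j}

/-- The subspace of vectors orthogonal to a family of vectors. -/
def frameCompl (B : V →ₛₗ[σ] V →ₗ[F] F) (e : ι → V) : Submodule F V :=
  LinearMap.ker (LinearMap.pi fun i => B (e i))

theorem mem_frameCompl {B : V →ₛₗ[σ] V →ₗ[F] F} {e : ι → V} {x : V} :
    x ∈ frameCompl B e ↔ ∀ i, B (e i) x = 0 := by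
  simp [frameCompl, funext_iff]

variable {B : V →ₛₗ[σ] V →ₗ[F] F} {G : Matrix ι ι F} {e : ι → V}

theorem apply_linearCombination_right [Fintype ι] (he : e ∈ gramFrames B G) (c : ι → F) (i : ι) :
    B (e i) (Fintype.linearCombination F e c) = (G.mulVec c) i := by
  simp [Fintype.linearCombination_apply, map_sum, Matrix.mulVec, dotProduct, he i, mul_comm]

variable (B e) in
/-- The map adding a linear combination of `e` to a vector orthogonal to `e`. -/
def splitMap [Fintype ι] : ((ι → F) × frameCompl B e) →ₗ[F] V :=
  (Fintype.linearCombination F e).coprod (frameCompl B e).subtype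

theorem splitMap_apply [Fintype ι] (p : (ι → F) × frameCompl B e) :
    splitMap B e p = Fintype.linearCombination F e p.1 + p.2 := rfl

theorem apply_splitMap_right [Fintype ι] (he : e ∈ gramFrames B G)
    (p : (ι → F) × frameCompl B e) (i : ι) : B (e i) (splitMap B e p) = (G.mulVec p.1) i := by
  rw [splitMap_apply, map_add, apply_linearCombination_right he, mem_frameCompl.1 p.2.2, add_zero]

/-- Orthogonal projection: the coefficients of `v` along `e` must be G⁻¹ applied to the pairings
B(eᵢ, v). Nondegeneracy of `B` on the whole space plays no role. -/
theorem splitMap_bijective [Fintype ι] [DecidableEq ι] (he : e ∈ gramFrames B G)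
    (hG : G.det ≠ 0) : Function.Bijective (splitMap B e) := by
  have hu : IsUnit G.det := isUnit_iff_ne_zero.2 hG
  constructor
  · rw [← LinearMap.ker_eq_bot, LinearMap.ker_eq_bot']
    intro p hp
    have h1 : p.1 = 0 := by
      refine Matrix.eq_zero_of_mulVec_eq_zero hG ?_
      ext i
      rw [← apply_splitMap_right he, hp, map_zero, Pi.zero_apply]
    have h2 : p.2 = 0 := by
      rw [splitMap_apply, h1, map_zero, zero_add] at hp
      exact Subtype.ext hp
    exact Prod.ext h1 h2
  · intro v
    set c : ι → F := (G⁻¹).mulVec fun i => B (e i) v with hc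
    have hw : v - Fintype.linearCombination F e c ∈ frameCompl B e := by
      rw [mem_frameCompl]
      intro i
      rw [map_sub, apply_linearCombination_right he, hc, Matrix.mulVec_mulVec,
        Matrix.mul_nonsing_inv _ hu, Matrix.one_mulVec, sub_self]
    exact ⟨(c, ⟨_, hw⟩), by simp [splitMap_apply]⟩

/-- A family with invertible Gram matrix splits off its orthogonal complement. -/
noncomputable def splitEquiv [Fintype ι] [DecidableEq ι] (he : e ∈ gramFrames B G)
    (hG : G.det ≠ 0) : ((ι → F) × frameCompl B e) ≃ₗ[F] V :=
  LinearEquiv.ofBijective (splitMap B e) (splitMap_bijective he hG)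

theorem splitEquiv_apply [Fintype ι] [DecidableEq ι] (he : e ∈ gramFrames B G)
    (hG : G.det ≠ 0) (p : (ι → F) × frameCompl B e) :
    splitEquiv he hG p = Fintype.linearCombination F e p.1 + p.2 := rfl

theorem linearIndependent_of_mem_gramFrames [Fintype ι] [DecidableEq ι]
    (he : e ∈ gramFrames B G) (hG : G.det ≠ 0) : LinearIndependent F e := by
  rw [Fintype.linearIndependent_iff]
  intro g hg i
  have : splitEquiv he hG (g, 0) = splitEquiv he hG 0 := by
    rw [splitEquiv_apply, map_zero, Fintype.linearCombination_apply, hg]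
    simp
  exact congrFun (congrArg Prod.fst ((splitEquiv he hG).injective this)) i

theorem finrank_frameCompl [Fintype ι] [DecidableEq ι] [FiniteDimensional F V]
    (he : e ∈ gramFrames B G) (hG : G.det ≠ 0) :
    Fintype.card ι + Module.finrank F (frameCompl B e) = Module.finrank F V := by
  rw [← (splitEquiv he hG).finrank_eq, Module.finrank_prod, Module.finrank_fintype_fun_eq_card]

theorem mem_frameCompl_flip (hB : B.IsRefl) {x : V} (hx : x ∈ frameCompl B e) (i : ι) :
    B x (e i) = 0 :=
  hB _ _ (mem_frameCompl.1 hx i)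

theorem apply_linearCombination_left [Fintype ι] (hB : B.IsRefl) {x : V}
    (hx : x ∈ frameCompl B e) (c : ι → F) : B (Fintype.linearCombination F e c) x = 0 := by
  refine hB _ _ ?_
  simp [Fintype.linearCombination_apply, map_sum, mem_frameCompl_flip hB hx]

theorem LinearMap.IsRefl.nondegenerate_of_right (hB : B.IsRefl)
    (h : ∀ y, (∀ x, B x y = 0) → y = 0) : B.Nondegenerate :=
  ⟨fun y hy => h y fun x => hB _ _ (hy x), fun y hy => h y hy⟩

theorem frameCompl_nondegenerate [Fintype ι] [DecidableEq ι] (hB : B.IsRefl)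
    (hN : B.Nondegenerate) (he : e ∈ gramFrames B G) (hG : G.det ≠ 0) :
    (B.domRestrict₁₂ (frameCompl B e) (frameCompl B e)).Nondegenerate := by
  refine (hB.domRestrict _).nondegenerate_of_right fun y hy => Subtype.ext (hN.2 _ fun x => ?_)
  obtain ⟨p, rfl⟩ := (splitEquiv he hG).surjective x
  rw [splitEquiv_apply, map_add, LinearMap.add_apply, apply_linearCombination_left hB y.2, zero_add]
  exact hy p.2

/-- The families with block diagonal Gram matrix. -/
noncomputable def gramFramesSumEquiv (hB : B.IsRefl) (G : Matrix ι ι F) (H : Matrix κ κ F) :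
    gramFrames B (Matrix.fromBlocks G 0 0 H) ≃
      Σ e : gramFrames B G, gramFrames (B.domRestrict₁₂ (frameCompl B e.1) (frameCompl B e.1)) H where
  toFun f := ⟨⟨fun i => f.1 (Sum.inl i), fun i j => f.2 (Sum.inl i) (Sum.inl j)⟩,
    ⟨fun k => ⟨f.1 (Sum.inr k), mem_frameCompl.2 fun i => f.2 (Sum.inl i) (Sum.inr k)⟩,
      fun i j => f.2 (Sum.inr i) (Sum.inr j)⟩⟩
  invFun p := ⟨Sum.elim p.1.1 fun k => (p.2.1 k : V), by
    rintro (i | i) (j | j)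
    · exact p.1.2 i j
    · exact mem_frameCompl.1 (p.2.1 j).2 i
    · exact mem_frameCompl_flip hB (p.2.1 i).2 j
    · exact p.2.2 i j⟩
  left_inv f := by
    ext i
    rcases i with i | i <;> rfl
  right_inv p := rfl

theorem Nat.cast_card_sigma_const {α : Type*} {β : α → Type*} [Finite α] [∀ a, Finite (β a)]
    {k : ℚ} (h : ∀ a, (Nat.card (β a) : ℚ) = k) :
    (Nat.card (Σ a, β a) : ℚ) = Nat.card α * k := by
  have := Fintype.ofFinite α
  rw [Nat.card_sigma, Nat.cast_sum, Finset.sum_congr rfl fun a _ => h a, Finset.sum_const,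
    nsmul_eq_mul, Finset.card_univ, Nat.card_eq_fintype_card]

end Frames

/-! ### Types of nondegenerate spaces, of restrictions and of quotients. -/

section Types

namespace FormCase

variable {F₀ F : Type*} [Field F₀] [Field F] [Algebra F₀ F]
  {V : Type*} [AddCommGroup V] [Module F V] {c : FormCase} {σ : F →+* F}
  {B : V →ₛₗ[σ] V →ₗ[F] F}

theorem IsForm.restrict (hB : c.IsForm F₀ σ B) (W : Submodule F V) :
    c.IsForm F₀ σ (B.domRestrict₁₂ W W) := by
  cases c with
  | hermitian => exact ⟨hB.1, hB.2.1, hB.2.2.1, fun x y => hB.2.2.2 x y⟩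
  | symmetric => exact ⟨hB.1, hB.2.1, hB.2.2.1, fun x y => hB.2.2.2 x y⟩
  | alternating => exact ⟨hB.1, hB.2.1, fun x => hB.2.2 x⟩

theorem IsForm.quotient (hB : c.IsForm F₀ σ B) (hr : B.IsRefl) (N : Submodule F V) :
    c.IsForm F₀ σ (quotientForm B hr N) := by
  have h2 {p : (↥N ⧸ (formRadical B N).submoduleOf N) → (↥N ⧸ (formRadical B N).submoduleOf N) → Prop}
      (h : ∀ x y : N, p (Submodule.Quotient.mk x) (Submodule.Quotient.mk y)) : ∀ x y, p x y := by
    intro x y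
    obtain ⟨x, rfl⟩ := Submodule.Quotient.mk_surjective _ x
    obtain ⟨y, rfl⟩ := Submodule.Quotient.mk_surjective _ y
    exact h x y
  cases c with
  | hermitian => exact ⟨hB.1, hB.2.1, hB.2.2.1, h2 fun x y => hB.2.2.2 x y⟩
  | symmetric => exact ⟨hB.1, hB.2.1, hB.2.2.1, h2 fun x y => hB.2.2.2 x y⟩
  | alternating =>
    exact ⟨hB.1, hB.2.1, fun x => h2 (p := fun x y => x = y → quotientForm B hr N x y = 0)
      (fun x y h => by rw [← h]; exact hB.2.2 x) x x rfl⟩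

theorem det_gram_ne_zero (hB : B.IsRefl) (hN : B.Nondegenerate) {ι : Type*} [Fintype ι]
    [DecidableEq ι] (b : Module.Basis ι F V) :
    (Matrix.of fun i j => B (b i) (b j)).det ≠ 0 := by
  intro h0
  obtain ⟨v, hv, hv0⟩ := Matrix.exists_mulVec_eq_zero_iff.2 h0
  have hb : ⇑b ∈ gramFrames B (Matrix.of fun i j => B (b i) (b j)) := fun i j => rfl
  set x := Fintype.linearCombination F b v with hx
  have h1 : B x = 0 := b.ext fun i => hB _ _ (by
    rw [hx, apply_linearCombination_right hb, hv0]; rfl)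
  have h2 : x = 0 := hN.1 x fun y => by rw [h1]; rfl
  refine hv (funext fun i => ?_)
  exact Fintype.linearIndependent_iff.1 b.linearIndependent v
    (by rw [← Fintype.linearCombination_apply, ← hx, h2]) i

variable [Fintype F] [DecidableEq F]

theorem sign_mul (c : FormCase) (a b : F) : c.sign F (a * b) = c.sign F a * c.sign F b := by
  cases c with
  | symmetric => exact map_mul (quadraticChar F) a b
  | _ => rfl

theorem sign_one (c : FormCase) : c.sign F 1 = 1 := by
  cases c <;> simp [sign]

theorem sign_mul_self (c : FormCase) {a : F} (ha : a ≠ 0) : c.sign F a * c.sign F a = 1 := by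
  cases c with
  | symmetric => rw [← sq]; exact quadraticChar_sq_one ha
  | _ => rfl

theorem gamma_pos (c : FormCase) : 0 < c.gamma := by
  cases c <;> simp [gamma]

theorem HasType.finrank_eq {d : ℕ} {χ : ℤ} (h : c.HasType B d χ) :
    Module.finrank F V = c.gamma * d := by
  obtain ⟨-, b, -⟩ := h
  rw [Module.finrank_eq_card_basis b, Fintype.card_fin]

theorem HasType.sign_det_eq {d : ℕ} {χ : ℤ} (hB : c.IsForm F₀ σ B) (h : c.HasType B d χ)
    {ι : Type*} [Fintype ι] [DecidableEq ι] (b : Module.Basis ι F V) :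
    c.sign F (Matrix.det (Matrix.of fun i j => B (b i) (b j))) = χ := by
  have hf := h.finrank_eq
  obtain ⟨-, b', rfl⟩ := h
  rw [Module.finrank_eq_card_basis b] at hf
  let f : Fin (c.gamma * d) ≃ ι := (Fintype.equivFinOfCardEq hf).symm
  rw [sign_det_gram_eq hB b' (b.reindex f.symm), ← Matrix.det_submatrix_equiv_self f]
  congr 2
  ext i j
  simp

theorem hasType_of_basis {d : ℕ} (hN : B.Nondegenerate)
    {ι : Type*} [Fintype ι] [DecidableEq ι] (b : Module.Basis ι F V)
    (hι : Fintype.card ι = c.gamma * d) :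
    c.HasType B d (c.sign F (Matrix.det (Matrix.of fun i j => B (b i) (b j)))) := by
  let f : Fin (c.gamma * d) ≃ ι := (Fintype.equivFinOfCardEq hι).symm
  refine ⟨hN, b.reindex f.symm, ?_⟩
  rw [← Matrix.det_submatrix_equiv_self f (Matrix.of fun i j => B (b i) (b j))]
  congr 2
  ext i j
  simp

theorem HasType.exists_ne_zero {d : ℕ} {χ : ℤ} (hB : B.IsRefl) (h : c.HasType B d χ) :
    ∃ a : F, a ≠ 0 ∧ c.sign F a = χ := by
  have hN := h.1
  obtain ⟨-, b, rfl⟩ := h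
  exact ⟨_, det_gram_ne_zero hB hN b, rfl⟩

variable {ι : Type*} [Fintype ι] [DecidableEq ι] {G : Matrix ι ι F} {e : ι → V}

/-- Nondegeneracy comes for free: a frame of full size leaves a zero complement, and then a radical
vector has coordinates in the kernel of G. -/
theorem hasType_of_gramFrame [FiniteDimensional F V] (hB : B.IsRefl) (he : e ∈ gramFrames B G)
    (hG : G.det ≠ 0) {d : ℕ} (hι : Fintype.card ι = c.gamma * d)
    (hV : Module.finrank F V = c.gamma * d) : c.HasType B d (c.sign F G.det) := by
  have h0 : Module.finrank F (frameCompl B e) = 0 := by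
    have := finrank_frameCompl he hG
    omega
  have hs : ∀ x : frameCompl B e, x = 0 := by
    have := Module.finrank_zero_iff.1 h0
    exact fun x => Subsingleton.elim _ _
  have hN : B.Nondegenerate := by
    refine hB.nondegenerate_of_right fun y hy => ?_
    obtain ⟨p, rfl⟩ := (splitEquiv he hG).surjective y
    have : p.1 = 0 := Matrix.eq_zero_of_mulVec_eq_zero hG
      (funext fun i => by rw [← apply_splitMap_right he]; exact hy _)
    rw [show p = 0 from Prod.ext this (hs p.2), map_zero]
  have hli := linearIndependent_of_mem_gramFrames he hG
  have hsp : ⊤ ≤ Submodule.span F (Set.range e) := by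
    intro y _
    obtain ⟨p, rfl⟩ := (splitEquiv he hG).surjective y
    rw [splitEquiv_apply, hs p.2, Submodule.coe_zero, add_zero, ← Fintype.range_linearCombination]
    exact ⟨_, rfl⟩
  have h := hasType_of_basis (c := c) hN (Module.Basis.mk hli hsp) hι
  convert h using 3
  ext i j
  simp [he i j]

/-- Adjoining a basis of the complement to `e` gives a basis of V with block diagonal Gram matrix,
so determinants multiply. Signs square to 1, hence dividing by the sign of G is multiplying by it.
-/
theorem hasType_frameCompl [FiniteDimensional F V] (hB : c.IsForm F₀ σ B) {r : ℕ} {χ : ℤ}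
    (hV : c.HasType B r χ) (he : e ∈ gramFrames B G) (hG : G.det ≠ 0) {n : ℕ}
    (hι : Fintype.card ι = c.gamma * n) :
    n ≤ r ∧ c.HasType (B.domRestrict₁₂ (frameCompl B e) (frameCompl B e)) (r - n)
      (χ * c.sign F G.det) := by
  have hf := finrank_frameCompl he hG
  rw [hι, hV.finrank_eq] at hf
  have hle : n ≤ r := Nat.le_of_mul_le_mul_left (by omega) c.gamma_pos
  have hW : Module.finrank F (frameCompl B e) = c.gamma * (r - n) := by
    rw [Nat.mul_sub]; omega
  refine ⟨hle, ?_⟩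
  let b := Module.finBasisOfFinrankEq F _ hW
  have hN := frameCompl_nondegenerate hB.isRefl hV.1 he hG
  have h := hasType_of_basis (c := c) hN b (Fintype.card_fin _)
  convert h using 1
  let b' := ((Pi.basisFun F ι).prod b).map (splitEquiv he hG)
  let f := (gramFramesSumEquiv hB.isRefl G _).symm ⟨⟨e, he⟩, ⟨b, fun i j =>
    (Matrix.of_apply (fun i j => B.domRestrict₁₂ (frameCompl B e) (frameCompl B e) (b i) (b j))
      i j).symm⟩⟩
  have hb' : ⇑b' = f.1 := by
    ext (i | i)
    · simp only [b', Module.Basis.map_apply, Module.Basis.prod_apply, splitEquiv_apply]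
      simp [f, gramFramesSumEquiv, Equiv.symm]
    · simp only [b', Module.Basis.map_apply, Module.Basis.prod_apply, splitEquiv_apply]
      simp [f, gramFramesSumEquiv, Equiv.symm]
  rw [← hV.sign_det_eq hB b']
  have : (Matrix.of fun i j => B (b' i) (b' j)) = Matrix.fromBlocks G 0 0
      (Matrix.of fun i j => B.domRestrict₁₂ (frameCompl B e) (frameCompl B e) (b i) (b j)) := by
    ext i j
    rw [Matrix.of_apply, hb']
    exact f.2 i j
  rw [this, Matrix.det_fromBlocks_zero₂₁, sign_mul, mul_right_comm, sign_mul_self c hG, one_mul]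

end FormCase
end Types

/-! ### Totally isotropic families, counted one vector at a time. -/

section IsoFrames

variable {F V : Type*} [Field F] [AddCommGroup V] [Module F V] {σ : F →+* F}

/-- The linearly independent families of pairwise orthogonal isotropic vectors. -/
def isoFrames (B : V →ₛₗ[σ] V →ₗ[F] F) (m : ℕ) : Set (Fin m → V) :=
  {u | LinearIndependent F u ∧ ∀ i j, B (u i) (u j) = 0}

/-- The nonzero isotropic vectors. -/
def isoVectors (B : V →ₛₗ[σ] V →ₗ[F] F) : Set V := {u | u ≠ 0 ∧ B u u = 0}

variable {B : V →ₛₗ[σ] V →ₗ[F] F}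

/-- An isotropic family is its first vector together with the remaining ones. -/
def isoFramesSuccEquiv (m : ℕ) : isoFrames B (m + 1) ≃
    Σ u : isoVectors B, {t : Fin m → V // (Fin.cons u.1 t : Fin (m + 1) → V) ∈ isoFrames B (m + 1)} where
  toFun f := ⟨⟨f.1 0, f.2.1.ne_zero 0, f.2.2 0 0⟩, ⟨Fin.tail f.1, by
    rw [Fin.cons_self_tail]; exact f.2⟩⟩
  invFun p := ⟨Fin.cons p.1.1 p.2.1, p.2.2⟩
  left_inv f := Subtype.ext (Fin.cons_self_tail f.1)
  right_inv p := rfl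

/-- The Gram matrix of an isotropic vector and a vector pairing to `1` with it. -/
def pairGram (B : V →ₛₗ[σ] V →ₗ[F] F) (u w : V) : Matrix (Fin 2) (Fin 2) F :=
  !![B u u, B u w; B w u, B w w]

theorem pair_mem_gramFrames (u w : V) : ![u, w] ∈ gramFrames B (pairGram B u w) := by
  intro i j
  fin_cases i <;> fin_cases j <;> rfl

/-- The norm of `w` drops out, so `w` need not be isotropic and no genuine hyperbolic pair has to be
constructed, even in characteristic 2. -/
theorem det_pairGram {u w : V} (hu : B u u = 0) : (pairGram B u w).det = -(B u w * B w u) := by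
  rw [pairGram, Matrix.det_fin_two_of, hu, zero_mul, zero_sub]

theorem det_pairGram_ne_zero (hB : B.IsRefl) {u w : V} (hu : B u u = 0) (hw : B u w = 1) :
    (pairGram B u w).det ≠ 0 := by
  rw [det_pairGram hu, hw, one_mul, neg_ne_zero]
  intro h
  exact one_ne_zero (hw.symm.trans (hB _ _ h))

theorem LinearMap.Nondegenerate.exists_apply_eq_one (hN : B.Nondegenerate) {u : V} (hu : u ≠ 0) :
    ∃ w, B u w = 1 := by
  by_contra! h
  refine hu (hN.1 u fun y => ?_)
  by_contra hy
  exact h ((B u y)⁻¹ • y) (by rw [map_smul, smul_eq_mul, inv_mul_cancel₀ hy])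

variable {u w : V} {m : ℕ}

theorem splitEquiv_pair (hG : (pairGram B u w).det ≠ 0) (a b : F)
    (x : frameCompl B ![u, w]) :
    splitEquiv (pair_mem_gramFrames u w) hG (![a, b], x) = a • u + b • w + x := by
  rw [splitEquiv_apply]
  simp [Fintype.linearCombination_apply]

/-- The orthogonal complement of u is Fu ⊕ {u, w}^⊥, and components along u affect neither
independence from u nor the pairings. -/
theorem cons_mem_isoFrames_iff (hB : B.IsRefl) (hu : B u u = 0) (hw : B u w = 1)
    (c : Fin m → F) (x : Fin m → frameCompl B ![u, w]) :
    (Fin.cons u (fun i => c i • u + (x i : V)) : Fin (m + 1) → V) ∈ isoFrames B (m + 1) ↔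
      x ∈ isoFrames (B.domRestrict₁₂ (frameCompl B ![u, w]) (frameCompl B ![u, w])) m := by
  have hG := det_pairGram_ne_zero hB hu hw
  have h1 (y : frameCompl B ![u, w]) : B u y = 0 := mem_frameCompl.1 y.2 0
  have h2 (y : frameCompl B ![u, w]) : B y u = 0 := hB _ _ (h1 y)
  refine and_congr ?_ ?_
  · rw [Fintype.linearIndependent_iff, Fintype.linearIndependent_iff]
    have key (g : Fin (m + 1) → F) :
        (∑ i, g i • (Fin.cons u (fun i => c i • u + (x i : V)) : Fin (m + 1) → V) i) =
        splitEquiv (pair_mem_gramFrames u w) hG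
          (![g 0 + ∑ i : Fin m, g i.succ * c i, 0], ∑ i : Fin m, g i.succ • x i) := by
      rw [splitEquiv_pair, Fin.sum_univ_succ]
      simp [Finset.sum_add_distrib, add_smul, Finset.sum_smul, mul_smul, add_assoc]
    constructor
    · intro h g hg i
      refine h (Fin.cons (-∑ i, g i * c i) g) ?_ i.succ
      rw [key]
      simp only [Fin.cons_succ, Fin.cons_zero, neg_add_cancel, hg]
      rw [splitEquiv_pair]
      simp
    · intro h g hg
      rw [key, LinearEquiv.map_eq_zero_iff, Prod.mk_eq_zero] at hg
      have h3 := h (fun i => g i.succ) hg.2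
      have h4 := congrFun hg.1 0
      intro i
      refine Fin.cases ?_ h3 i
      simpa [h3] using h4
  · constructor
    · intro h i j
      have := h i.succ j.succ
      change B (x i : V) (x j : V) = 0
      simpa [hu, h1, h2] using this
    · intro h i j
      have h' (i j) : B (x i : V) (x j : V) = 0 := h i j
      refine Fin.cases ?_ (fun i => ?_) i <;> refine Fin.cases ?_ (fun j => ?_) j <;>
        simp [hu, h1, h2, h']

/-- The power of |F| accounts for the free coefficients along u of the m later vectors. -/
theorem card_cons_isoFrames (hB : B.IsRefl) (hu : B u u = 0) (hw : B u w = 1) :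
    Nat.card {t : Fin m → V // (Fin.cons u t : Fin (m + 1) → V) ∈ isoFrames B (m + 1)} =
      Nat.card F ^ m *
        Nat.card (isoFrames (B.domRestrict₁₂ (frameCompl B ![u, w]) (frameCompl B ![u, w])) m) := by
  have hG := det_pairGram_ne_zero hB hu hw
  have hc : Nat.card (Fin m → F) = Nat.card F ^ m := by rw [Nat.card_fun, Nat.card_fin]
  rw [← hc, ← Nat.card_prod]
  refine (Nat.card_congr (Equiv.ofBijective (fun p => ⟨fun i => p.1 i • u + (p.2.1 i : V),
    (cons_mem_isoFrames_iff hB hu hw _ _).2 p.2.2⟩) ⟨?_, ?_⟩)).symm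
  · rintro ⟨c, x⟩ ⟨d, y⟩ h
    have h1 (i) : (c i, x.1 i) = (d i, y.1 i) := by
      have h2 := congrFun (congrArg Subtype.val h) i
      have h3 : splitEquiv (pair_mem_gramFrames u w) hG (![c i, 0], x.1 i) =
          splitEquiv (pair_mem_gramFrames u w) hG (![d i, 0], y.1 i) := by
        rw [splitEquiv_pair, splitEquiv_pair]
        simpa using h2
      have h4 := Prod.mk.inj ((splitEquiv _ hG).injective h3)
      exact Prod.ext (congrFun h4.1 0) h4.2
    exact Prod.ext (funext fun i => congrArg Prod.fst (h1 i))
      (Subtype.ext (funext fun i => congrArg Prod.snd (h1 i)))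
  · rintro ⟨t, ht⟩
    have h1 (i) : ∃ c : F, ∃ x : frameCompl B ![u, w], t i = c • u + x := by
      obtain ⟨⟨c, x⟩, hp⟩ := (splitEquiv (pair_mem_gramFrames u w) hG).surjective (t i)
      have h2 : c = ![c 0, c 1] := by ext i; fin_cases i <;> rfl
      rw [h2, splitEquiv_pair] at hp
      have h3 : B u (t i) = 0 := by simpa using ht.2 0 i.succ
      rw [← hp, map_add, map_add, map_smul, map_smul, hu, hw,
        show B u x = 0 from mem_frameCompl.1 x.2 0] at h3
      -- Pairing with u reads off the coefficient of w, so orthogonality to u kills it.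
      have h4 : c 1 = 0 := by simpa using h3
      exact ⟨c 0, x, by rw [← hp, h4, zero_smul, add_zero]⟩
    choose c x hx using h1
    obtain rfl : t = fun i => c i • u + (x i : V) := funext hx
    exact ⟨(c, ⟨x, (cons_mem_isoFrames_iff hB hu hw c x).1 ht⟩), rfl⟩

/-- The isotropic families are counted by extending isotropic vectors. -/
theorem card_isoFrames_succ [Finite V] (hB : B.IsRefl) (hN : B.Nondegenerate) {k : ℚ}
    (h : ∀ u w, B u u = 0 → B u w = 1 → (Nat.card (isoFrames (B.domRestrict₁₂
      (frameCompl B ![u, w]) (frameCompl B ![u, w])) m) : ℚ) = k) :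
    (Nat.card (isoFrames B (m + 1)) : ℚ) = Nat.card (isoVectors B) * (Nat.card F ^ m * k) := by
  rw [Nat.card_congr (isoFramesSuccEquiv m)]
  refine Nat.cast_card_sigma_const fun u => ?_
  obtain ⟨w, hw⟩ := hN.exists_apply_eq_one u.2.1
  rw [card_cons_isoFrames hB u.2.2 hw, Nat.cast_mul, h _ _ u.2.2 hw, Nat.cast_pow]

theorem card_isoFrames_zero : Nat.card (isoFrames B 0) = 1 := by
  have : Unique (isoFrames B 0) := ⟨⟨⟨Fin.elim0, linearIndependent_empty_type, fun i => i.elim0⟩⟩,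
    fun x => Subtype.ext (Subsingleton.elim _ _)⟩
  exact Nat.card_unique

end IsoFrames

/-! ### Double counting of mixed frames by their span. -/

section DoubleCount

variable {F V : Type*} [Field F] [AddCommGroup V] [Module F V] {σ : F →+* F}
  {B : V →ₛₗ[σ] V →ₗ[F] F} {κ : Type*} {G : Matrix κ κ F} {m : ℕ}

/-- The pairs of a family with Gram matrix `G` and an isotropic family orthogonal to it. -/
abbrev MixedFrames (B : V →ₛₗ[σ] V →ₗ[F] F) (G : Matrix κ κ F) (m : ℕ) : Type _ :=
  Σ e : gramFrames B G, isoFrames (B.domRestrict₁₂ (frameCompl B e.1) (frameCompl B e.1)) m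

/-- The span of the isotropic part of a mixed family. -/
def MixedFrames.isoSpan (t : MixedFrames B G m) : Submodule F V :=
  Submodule.span F (Set.range fun i => (t.2.1 i : V))

/-- The span of a mixed family. -/
def MixedFrames.span (t : MixedFrames B G m) : Submodule F V :=
  Submodule.span F (Set.range t.1.1) ⊔ t.isoSpan

namespace MixedFrames

variable (t : MixedFrames B G m)

theorem iso_mem (i : Fin m) : (t.2.1 i : V) ∈ t.isoSpan :=
  Submodule.subset_span ⟨i, rfl⟩

theorem gram_mem (i : κ) : t.1.1 i ∈ t.span :=
  Submodule.mem_sup_left (Submodule.subset_span ⟨i, rfl⟩)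

theorem isoSpan_le_frameCompl : t.isoSpan ≤ frameCompl B t.1.1 := by
  rw [isoSpan, Submodule.span_le]
  rintro _ ⟨i, rfl⟩
  exact (t.2.1 i).2

theorem linearIndependent_iso : LinearIndependent F fun i => (t.2.1 i : V) :=
  t.2.2.1.map' _ (Submodule.ker_subtype _)

theorem finrank_isoSpan : Module.finrank F t.isoSpan = m := by
  rw [isoSpan, finrank_span_eq_card t.linearIndependent_iso, Fintype.card_fin]

theorem span_le_ker (hB : B.IsRefl) (j : Fin m) : t.span ≤ LinearMap.ker (B (t.2.1 j)) := by
  rw [span, isoSpan, sup_le_iff, Submodule.span_le, Submodule.span_le]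
  constructor
  · rintro _ ⟨i, rfl⟩
    exact mem_frameCompl_flip hB (t.2.1 j).2 i
  · rintro _ ⟨i, rfl⟩
    exact t.2.2.2 j i

variable [Fintype κ] [DecidableEq κ]

theorem eq_zero_of_mem_frameCompl (hG : G.det ≠ 0) (c : κ → F)
    (h : Fintype.linearCombination F t.1.1 c ∈ frameCompl B t.1.1) : c = 0 := by
  refine Matrix.eq_zero_of_mulVec_eq_zero hG (funext fun i => ?_)
  rw [← apply_linearCombination_right t.1.2]
  exact mem_frameCompl.1 h i

/-- A radical vector is a combination of `e` plus an isotropic part. The isotropic part is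
orthogonal to `e`, so the combination is too, and it vanishes because G is invertible. -/
theorem formRadical_span (hB : B.IsRefl) (hG : G.det ≠ 0) :
    formRadical B t.span = t.isoSpan := by
  refine le_antisymm ?_ ?_
  · rintro x ⟨hx, hx'⟩
    obtain ⟨y, hy, z, hz, rfl⟩ := Submodule.mem_sup.1 hx
    rw [← Fintype.range_linearCombination] at hy
    obtain ⟨c, rfl⟩ := hy
    have hzc := t.isoSpan_le_frameCompl hz
    have hc : Fintype.linearCombination F t.1.1 c ∈ frameCompl B t.1.1 := by
      rw [← Submodule.add_mem_iff_left _ hzc]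
      exact mem_frameCompl.2 fun i => hx' _ (t.gram_mem i)
    rw [t.eq_zero_of_mem_frameCompl hG c hc, map_zero, zero_add]
    exact hz
  · rw [isoSpan, Submodule.span_le]
    rintro _ ⟨j, rfl⟩
    exact ⟨Submodule.mem_sup_right (t.iso_mem j), fun x hx => hB _ _ (t.span_le_ker hB j hx)⟩

theorem finrank_span [FiniteDimensional F V] (hG : G.det ≠ 0) :
    Module.finrank F t.span = Fintype.card κ + m := by
  have h := Submodule.finrank_sup_add_finrank_inf_eq (Submodule.span F (Set.range t.1.1)) t.isoSpan
  have h0 : Submodule.span F (Set.range t.1.1) ⊓ t.isoSpan = ⊥ := by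
    rw [eq_bot_iff]
    rintro x ⟨hx, hx'⟩
    rw [← Fintype.range_linearCombination] at hx
    obtain ⟨c, rfl⟩ := hx
    rw [t.eq_zero_of_mem_frameCompl hG c (t.isoSpan_le_frameCompl hx'), map_zero]
    exact Submodule.zero_mem _
  rw [h0, finrank_bot, add_zero, finrank_isoSpan,
    finrank_span_eq_card (linearIndependent_of_mem_gramFrames t.1.2 hG)] at h
  exact h

end MixedFrames

theorem finrank_formRadical_submoduleOf (N : Submodule F V) :
    Module.finrank F ((formRadical B N).submoduleOf N) = Module.finrank F (formRadical B N) :=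
  (Submodule.submoduleOfEquivOfLe (inf_le_left : formRadical B N ≤ N)).finrank_eq

theorem finrank_quotient_formRadical [FiniteDimensional F V] (N : Submodule F V) :
    Module.finrank F (↥N ⧸ (formRadical B N).submoduleOf N) +
      Module.finrank F (formRadical B N) = Module.finrank F N := by
  rw [← Submodule.finrank_quotient_add_finrank ((formRadical B N).submoduleOf N),
    finrank_formRadical_submoduleOf]

theorem apply_formRadical_right {N : Submodule F V} (x : N) {y : V}
    (hy : y ∈ formRadical B N) : B x y = 0 :=
  hy.2 x x.2

/-- Pairings do not see the radical, so each frame of the quotient lifts freely: a linear section g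
of the projection makes the lifts a torsor under families in the radical. -/
theorem card_gramFrames_quotient [Fintype κ] [Finite V] [Fintype F] (hB : B.IsRefl)
    (N : Submodule F V) (G : Matrix κ κ F) :
    Nat.card (gramFrames (B.domRestrict₁₂ N N) G) = Nat.card (gramFrames (quotientForm B hB N) G) *
      Fintype.card F ^ (Module.finrank F (formRadical B N) * Fintype.card κ) := by
  obtain ⟨g, hg⟩ := ((formRadical B N).submoduleOf N).mkQ.exists_rightInverse_of_surjective
    (Submodule.range_mkQ _)
  have hg' (x) : Submodule.Quotient.mk (g x) = x := LinearMap.congr_fun hg x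
  have hR (x : N) : x - g (Submodule.Quotient.mk x) ∈ (formRadical B N).submoduleOf N := by
    rw [← Submodule.Quotient.mk_eq_zero, Submodule.Quotient.mk_sub, hg', sub_self]
  have hm (x : _ ⧸ (formRadical B N).submoduleOf N) (y : (formRadical B N).submoduleOf N) :
      Submodule.Quotient.mk (g x + y : N) = x := by
    rw [Submodule.Quotient.mk_add, hg', (Submodule.Quotient.mk_eq_zero _).2 y.2, add_zero]
  have hc : Nat.card (κ → (formRadical B N).submoduleOf N) =
      Fintype.card F ^ (Module.finrank F (formRadical B N) * Fintype.card κ) := by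
    rw [Nat.card_fun, Module.natCard_eq_pow_finrank (K := F),
      finrank_formRadical_submoduleOf,
      Nat.card_eq_fintype_card, Nat.card_eq_fintype_card, ← pow_mul]
  rw [← hc, ← Nat.card_prod]
  exact Nat.card_congr
    { toFun := fun e => (⟨fun i => Submodule.Quotient.mk (e.1 i), fun i j => e.2 i j⟩,
        fun i => ⟨_, hR (e.1 i)⟩)
      invFun := fun p => ⟨fun i => g (p.1.1 i) + (p.2 i : N), fun i j => by
        have h := p.1.2 i j
        rw [← hm (p.1.1 i) (p.2 i), ← hm (p.1.1 j) (p.2 j)] at h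
        exact h⟩
      left_inv := fun e => by ext i; simp
      right_inv := fun p => by
        refine Prod.ext (Subtype.ext (funext fun i => hm _ _)) (funext fun i => Subtype.ext ?_)
        simp [hm] }

namespace FormCase

variable {F₀ : Type*} [Field F₀] [Algebra F₀ F] {c : FormCase} [Fintype F] [DecidableEq F]
  [Finite V] [Fintype κ] [DecidableEq κ]

/-- The subspaces with radical of dimension `m` and nondegenerate quotient of type `(n, ψ)`. -/
abbrev TypedSubspaces (c : FormCase) (B : V →ₛₗ[σ] V →ₗ[F] F) (hB : B.IsRefl)
    (m n : ℕ) (ψ : ℤ) : Type _ :=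
  {N : Submodule F V // Module.finrank F (formRadical B N) = m ∧
    c.HasType (quotientForm B hB N) n ψ}

theorem hasType_quotient_span (hB : B.IsRefl) (hG : G.det ≠ 0) {n : ℕ}
    (hκ : Fintype.card κ = c.gamma * n) (t : MixedFrames B G m) :
    c.HasType (quotientForm B hB t.span) n (c.sign F G.det) := by
  have : FiniteDimensional F V := Module.Finite.of_finite
  have hr : (quotientForm B hB t.span).IsRefl := by
    intro x y
    obtain ⟨x, rfl⟩ := Submodule.Quotient.mk_surjective _ x
    obtain ⟨y, rfl⟩ := Submodule.Quotient.mk_surjective _ y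
    exact hB x y
  refine hasType_of_gramFrame hr
    (e := fun i => Submodule.Quotient.mk ⟨t.1.1 i, t.gram_mem i⟩)
    (fun i j => (quotientForm_mk B hB t.span _ _).trans (t.1.2 i j)) hG hκ ?_
  have h := finrank_quotient_formRadical (B := B) t.span
  have h1 : Module.finrank F (formRadical B t.span) = m := by
    rw [t.formRadical_span hB hG, t.finrank_isoSpan]
  rw [t.finrank_span hG] at h
  omega

/-- A mixed frame spans N exactly when its Gram part lies in N and its isotropic part is a basis of
the radical of N; equality of spans is then forced by dimension. The product is the order of
GL_m(F). -/
theorem card_mixedFrames_span_eq (hB : B.IsRefl) (hG : G.det ≠ 0) {n : ℕ} {ψ : ℤ}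
    (hκ : Fintype.card κ = c.gamma * n) (N : TypedSubspaces c B hB m n ψ) :
    Nat.card {t : MixedFrames B G m // t.span = N.1} =
      Nat.card (gramFrames (B.domRestrict₁₂ N.1 N.1) G) *
        ∏ i : Fin m, (Fintype.card F ^ m - Fintype.card F ^ (i : ℕ)) := by
  have : FiniteDimensional F V := Module.Finite.of_finite
  obtain ⟨N, hm, hN⟩ := N
  have hc := card_linearIndependent (K := F) (V := formRadical B N) hm.ge
  rw [hm] at hc
  rw [← hc, ← Nat.card_prod]
  have hmem (t : MixedFrames B G m) (ht : t.span = N) (i) : t.1.1 i ∈ N := ht ▸ t.gram_mem i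
  have hrad (t : MixedFrames B G m) (ht : t.span = N) (i) : (t.2.1 i : V) ∈ formRadical B N := by
    rw [← ht, t.formRadical_span hB hG]
    exact t.iso_mem i
  have hfin : Module.finrank F N = Fintype.card κ + m := by
    rw [← finrank_quotient_formRadical (B := B) N, hm, hN.finrank_eq, hκ]
  let mk (p : gramFrames (B.domRestrict₁₂ N N) G ×
      {u : Fin m → formRadical B N // LinearIndependent F u}) : MixedFrames B G m :=
    ⟨⟨fun i => p.1.1 i, p.1.2⟩, ⟨fun j => ⟨p.2.1 j, mem_frameCompl.2 fun i =>
      apply_formRadical_right (p.1.1 i) (p.2.1 j).2⟩,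
      LinearIndependent.of_comp (frameCompl B _).subtype
        (p.2.2.map' (formRadical B N).subtype (Submodule.ker_subtype _)),
      fun i j => apply_formRadical_right (B := B) ⟨p.2.1 i, (p.2.1 i).2.1⟩ (p.2.1 j).2⟩⟩
  have hmk (p) : (mk p).span = N := by
    refine Submodule.eq_of_le_of_finrank_eq ?_ ?_
    · rw [MixedFrames.span, MixedFrames.isoSpan, sup_le_iff, Submodule.span_le, Submodule.span_le]
      constructor
      · rintro _ ⟨i, rfl⟩
        exact (p.1.1 i).2
      · rintro _ ⟨i, rfl⟩
        exact (p.2.1 i).2.1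
    · rw [MixedFrames.finrank_span _ hG, hfin]
  exact Nat.card_congr
    { toFun := fun t => (⟨fun i => ⟨t.1.1.1 i, hmem t.1 t.2 i⟩, t.1.1.2⟩,
        ⟨fun i => ⟨t.1.2.1 i, hrad t.1 t.2 i⟩,
          LinearIndependent.of_comp (formRadical B N).subtype t.1.linearIndependent_iso⟩)
      invFun := fun p => ⟨mk p, hmk p⟩
      left_inv := fun t => rfl
      right_inv := fun p => rfl }

/-- Counting mixed families by their span. -/
theorem card_mixedFrames (hB : B.IsRefl) (hG : G.det ≠ 0) {n : ℕ} {k : ℚ}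
    (hκ : Fintype.card κ = c.gamma * n)
    (hk : ∀ N : TypedSubspaces c B hB m n (c.sign F G.det),
      (Nat.card (gramFrames (quotientForm B hB N.1) G) : ℚ) = k) :
    (Nat.card (MixedFrames B G m) : ℚ) = Nat.card (TypedSubspaces c B hB m n (c.sign F G.det)) *
      (k * Fintype.card F ^ (m * Fintype.card κ) *
        ((∏ i : Fin m, (Fintype.card F ^ m - Fintype.card F ^ (i : ℕ)) : ℕ) : ℚ)) := by
  let f (t : MixedFrames B G m) : TypedSubspaces c B hB m n (c.sign F G.det) :=
    ⟨t.span, by rw [t.formRadical_span hB hG, t.finrank_isoSpan],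
      hasType_quotient_span hB hG hκ t⟩
  rw [← Nat.card_congr (Equiv.sigmaFiberEquiv f)]
  refine Nat.cast_card_sigma_const fun N => ?_
  rw [← hk N, ← congrArg (fun d => (Fintype.card F : ℚ) ^ (d * Fintype.card κ)) N.2.1]
  have h1 := card_gramFrames_quotient hB N.1 G
  have h2 := card_mixedFrames_span_eq hB hG hκ N
  rw [h1] at h2
  have h3 : Nat.card {t : MixedFrames B G m // f t = N} =
      Nat.card {t : MixedFrames B G m // t.span = N.1} :=
    Nat.card_congr (Equiv.subtypeEquivRight fun t => Subtype.ext_iff)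
  rw [h3, h2]
  push_cast
  rfl

end FormCase

end DoubleCount

/-! ### Character sums over the finite field. -/

section ScalarSums

open Finset

/-- The function with value `Q - 1` at `0` and `-1` elsewhere. -/
def zeroDev {F : Type*} [Zero F] [DecidableEq F] (Q : ℤ) (y : F) : ℤ := if y = 0 then Q - 1 else -1

theorem zeroDev_eq {F : Type*} [Zero F] [DecidableEq F] (Q : ℤ) (y : F) : zeroDev Q y = Q * (if y = 0 then 1 else 0) - 1 := by
  unfold zeroDev; split_ifs <;> ring

variable {F : Type*} [Field F] [Fintype F] [DecidableEq F]

theorem sum_zeroDev_sub (a : F) :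
    ∑ y : F, zeroDev (Fintype.card F) (a - y) = 0 := by
  simp [zeroDev_eq, sub_eq_zero, Finset.sum_sub_distrib]

/-- For a ≠ 0 the substitution y = at gives the Jacobi sum of the quadratic character η with itself,
which is -η(-1) because η is its own inverse. For a = 0 each of the q - 1 nonzero terms is η(-1). -/
theorem sum_quadraticChar_mul_sub (hF : ringChar F ≠ 2) (a : F) :
    ∑ y : F, quadraticChar F y * quadraticChar F (a - y) =
      quadraticChar F (-1) * zeroDev (Fintype.card F) a := by
  unfold zeroDev
  split_ifs with ha
  · subst ha
    have h (y : F) : quadraticChar F y * quadraticChar F (0 - y) =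
        quadraticChar F (-1) * if y = 0 then 0 else 1 := by
      rw [zero_sub, ← neg_one_mul y, map_mul, mul_left_comm, ← sq]
      split_ifs with hy
      · simp [hy]
      · rw [quadraticChar_sq_one hy]
    rw [Finset.sum_congr rfl fun y _ => h y, ← Finset.mul_sum]
    congr 1
    rw [Finset.sum_ite]
    simp [Finset.filter_ne', Finset.card_univ, Nat.cast_sub, Nat.one_le_iff_ne_zero]
  · have h : ∑ y : F, quadraticChar F y * quadraticChar F (a - y) =
        ∑ t : F, quadraticChar F t * quadraticChar F (1 - t) := by
      refine (Fintype.sum_equiv (Equiv.mulLeft₀ a ha) _ _ fun t => ?_).symm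
      rw [Equiv.mulLeft₀_apply, show a - a * t = a * (1 - t) by ring, map_mul, map_mul]
      linear_combination (-(quadraticChar F t * quadraticChar F (1 - t))) * quadraticChar_sq_one ha
    rw [h, mul_neg_one, ← jacobiSum_nontrivial_inv (quadraticChar_ne_one hF),
      (quadraticChar_isQuadratic F).inv]
    rfl

/-- An element t has 1 + η(t) square roots, and η(t) = η(dy) for y = dt. -/
theorem sum_comp_mul_sq (hF : ringChar F ≠ 2) {d : F} (hd : d ≠ 0) (f : F → ℤ) :
    ∑ x : F, f (x * d * x) = ∑ y : F, f y * (1 + quadraticChar F (d * y)) := by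
  have h1 (x : F) : f (x * d * x) = ∑ t : F, if x ^ 2 = t then f (d * t) else 0 := by
    rw [Finset.sum_ite_eq, if_pos (mem_univ _)]
    congr 1; ring
  have h2 (t : F) : (∑ x : F, if x ^ 2 = t then f (d * t) else 0) =
      f (d * t) * (1 + quadraticChar F t) := by
    rw [← Finset.sum_filter, Finset.sum_const, nsmul_eq_mul, mul_comm, add_comm,
      ← quadraticChar_card_sqrts hF t]
    congr 3
    ext; simp
  rw [Finset.sum_congr rfl fun x _ => h1 x, Finset.sum_comm, Finset.sum_congr rfl fun t _ => h2 t]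
  refine Fintype.sum_equiv (Equiv.mulLeft₀ d hd) _ _ fun t => ?_
  rw [Equiv.mulLeft₀_apply, ← mul_assoc, map_mul, ← sq, quadraticChar_sq_one' hd, one_mul]

end ScalarSums

/-! ### The norm of a quadratic extension of finite fields. -/

section QuadraticExtension

variable {F₀ F : Type*} [Field F₀] [Field F] [Fintype F] [Algebra F₀ F] {σ : F →+* F}

/-- A ring endomorphism fixing the base field, as an algebra automorphism. -/
noncomputable def conjAut (σ : F →+* F) (hσ : ∀ a : F₀, σ (algebraMap F₀ F a) = algebraMap F₀ F a) :
    F ≃ₐ[F₀] F :=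
  AlgEquiv.ofBijective (⟨σ, hσ⟩ : F →ₐ[F₀] F) (Finite.injective_iff_bijective.1 σ.injective)

theorem univ_aut_eq (h2 : Module.finrank F₀ F = 2)
    (hσ : ∀ a : F₀, σ (algebraMap F₀ F a) = algebraMap F₀ F a) (h1 : σ ≠ RingHom.id F)
    [Fintype (F ≃ₐ[F₀] F)] [DecidableEq (F ≃ₐ[F₀] F)] :
    (Finset.univ : Finset (F ≃ₐ[F₀] F)) = {1, conjAut σ hσ} := by
  have hne : (1 : F ≃ₐ[F₀] F) ≠ conjAut σ hσ := by
    intro h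
    refine h1 (RingHom.ext fun x => ?_)
    exact (AlgEquiv.congr_fun h x).symm
  refine (Finset.eq_univ_of_card _ ?_).symm
  rw [Finset.card_pair hne, ← h2, ← Nat.card_eq_fintype_card, IsGalois.card_aut_eq_finrank]

/-- This identifies the rank one Hermitian form with the field norm, whose fibres can be counted. -/
theorem algebraMap_norm_eq_mul (h2 : Module.finrank F₀ F = 2)
    (hσ : ∀ a : F₀, σ (algebraMap F₀ F a) = algebraMap F₀ F a) (h1 : σ ≠ RingHom.id F) (x : F) :
    algebraMap F₀ F (Algebra.norm F₀ x) = σ x * x := by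
  classical
  have hne : (1 : F ≃ₐ[F₀] F) ≠ conjAut σ hσ := by
    intro h
    refine h1 (RingHom.ext fun x => ?_)
    exact (AlgEquiv.congr_fun h x).symm
  rw [Algebra.norm_eq_prod_automorphisms, univ_aut_eq h2 hσ h1, Finset.prod_pair hne, mul_comm]
  rfl

theorem exists_algebraMap_eq (h2 : Module.finrank F₀ F = 2)
    (hσ : ∀ a : F₀, σ (algebraMap F₀ F a) = algebraMap F₀ F a) (h1 : σ ≠ RingHom.id F) {x : F}
    (hx : σ x = x) : ∃ a : F₀, algebraMap F₀ F a = x := by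
  classical
  refine (IsGalois.mem_range_algebraMap_iff_fixed x).2 fun f => ?_
  have := Finset.mem_univ f
  rw [univ_aut_eq h2 hσ h1, Finset.mem_insert, Finset.mem_singleton] at this
  rcases this with rfl | rfl
  · rfl
  · exact hx

theorem card_eq_sq [Fintype F₀] (h2 : Module.finrank F₀ F = 2) :
    Fintype.card F = Fintype.card F₀ ^ 2 := by
  rw [← h2, ← Module.card_eq_pow_finrank]

variable [DecidableEq F₀]

theorem card_norm_eq_zero :
    (Finset.univ.filter fun x : F => Algebra.norm F₀ x = 0).card = 1 := by
  rw [Finset.card_eq_one]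
  exact ⟨0, by ext x; simp⟩

variable [Fintype F₀]

/-- The norm is surjective and its nonzero fibres are multiplicative translates of each other, so
q₀² - 1 elements are shared equally among q₀ - 1 values. -/
theorem card_norm_eq (h2 : Module.finrank F₀ F = 2) {t : F₀} (ht : t ≠ 0) :
    (Finset.univ.filter fun x : F => Algebra.norm F₀ x = t).card = Fintype.card F₀ + 1 := by
  have hk {t : F₀} (ht : t ≠ 0) : (Finset.univ.filter fun x : F => Algebra.norm F₀ x = t).card =
      (Finset.univ.filter fun x : F => Algebra.norm F₀ x = 1).card := by
    obtain ⟨y, rfl⟩ := FiniteField.norm_surjective F₀ F t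
    have hy : y ≠ 0 := by rintro rfl; exact ht (Algebra.norm_zero)
    refine (Finset.card_equiv (Equiv.mulRight₀ y hy) fun x => ?_).symm
    simp [ht]
  have h := Finset.card_eq_sum_card_fiberwise (f := fun x : F => Algebra.norm F₀ x)
    (s := Finset.univ) (t := Finset.univ) fun _ _ => Finset.mem_coe.2 (Finset.mem_univ _)
  rw [← Finset.add_sum_erase _ _ (Finset.mem_univ (0 : F₀)), card_norm_eq_zero,
    Finset.sum_congr rfl fun t ht => hk (Finset.ne_of_mem_erase ht), Finset.sum_const,
    Finset.card_erase_of_mem (Finset.mem_univ _), Finset.card_univ, Finset.card_univ,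
    card_eq_sq h2, smul_eq_mul] at h
  rw [hk ht]
  have h1 : 1 < Fintype.card F₀ := Fintype.one_lt_card
  obtain ⟨s, hs⟩ : ∃ s, Fintype.card F₀ = s + 2 := ⟨_, (Nat.sub_add_cancel h1).symm⟩
  rw [hs] at h ⊢
  have : (s + 1) * (Finset.univ.filter fun x : F => Algebra.norm F₀ x = 1).card =
      (s + 1) * (s + 2 + 1) := by
    simp only [show s + 2 - 1 = s + 1 by omega] at h
    nlinarith
  exact Nat.eq_of_mul_eq_mul_left (by omega) this

/-- The inductive step of the Hermitian count: adding an orthogonal line multiplies the deviation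
from equidistribution by -q₀. -/
theorem sum_zeroDev_norm (h2 : Module.finrank F₀ F = 2) {d : F₀} (hd : d ≠ 0) (a : F₀) :
    ∑ x : F, zeroDev (Fintype.card F₀) (a - d * Algebra.norm F₀ x) =
      -Fintype.card F₀ * zeroDev (Fintype.card F₀) a := by
  have h (x : F) : a - d * Algebra.norm F₀ x = 0 ↔ Algebra.norm F₀ x = d⁻¹ * a := by
    rw [sub_eq_zero, eq_inv_mul_iff_mul_eq₀ hd, eq_comm]
  simp only [zeroDev_eq, h, Finset.sum_sub_distrib, ← Finset.mul_sum, Finset.sum_boole]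
  by_cases ha : a = 0
  · simp [ha, card_norm_eq_zero, card_eq_sq h2, -Algebra.norm_eq_zero_iff]; ring
  · rw [card_norm_eq h2 (mul_ne_zero (inv_ne_zero hd) ha)]
    simp [ha, card_eq_sq h2]; ring

end QuadraticExtension

/-! ### The number of vectors of given norm. -/

section NormCount

variable {F V : Type*} [Field F] [AddCommGroup V] [Module F V] {σ : F →+* F}

/-- The number of vectors of norm `a`. -/
noncomputable def normCount (B : V →ₛₗ[σ] V →ₗ[F] F) (a : F) : ℕ := Nat.card {x : V // B x x = a}

variable {B : V →ₛₗ[σ] V →ₗ[F] F} {v : V}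

/-- The `1 × 1` Gram matrix. -/
abbrev singleGram (d : F) : Matrix Unit Unit F := Matrix.of fun _ _ => d

theorem single_mem_gramFrames : (fun _ : Unit => v) ∈ gramFrames B (singleGram (B v v)) :=
  fun _ _ => rfl

theorem det_singleGram (d : F) : (singleGram d).det = d := by simp

/-- Since V = Fv ⊥ v^⊥, the component xv uses up σ(x)B(v, v)x of the norm and the rest must come
from v^⊥. -/
theorem normCount_eq_sum [Fintype F] [Finite V] (hB : B.IsRefl) (hv : B v v ≠ 0) (a : F) :
    normCount B a = ∑ x : F, normCount (B.domRestrict₁₂ (frameCompl B fun _ : Unit => v)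
      (frameCompl B fun _ : Unit => v)) (a - σ x * B v v * x) := by
  have hG : (singleGram (B v v)).det ≠ 0 := by rwa [det_singleGram]
  let e : (F × frameCompl B fun _ : Unit => v) ≃ₗ[F] V :=
    ((LinearEquiv.funUnique Unit F F).symm.prodCongr (LinearEquiv.refl F _)).trans
      (splitEquiv single_mem_gramFrames hG)
  have he (p) : e p = p.1 • v + p.2 := by
    change splitEquiv single_mem_gramFrames hG _ = _
    rw [splitEquiv_apply]
    simp [Fintype.linearCombination_apply]
  have hB' (p) : B (e p) (e p) = a ↔
      B.domRestrict₁₂ (frameCompl B fun _ : Unit => v) (frameCompl B fun _ : Unit => v) p.2 p.2 =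
        a - σ p.1 * B v v * p.1 := by
    have h1 : B v p.2 = 0 := mem_frameCompl.1 p.2.2 ()
    have h2 : B p.2 v = 0 := hB _ _ h1
    rw [he, eq_sub_iff_add_eq]
    simp only [map_add, LinearMap.add_apply, map_smul, LinearMap.map_smulₛₗ, LinearMap.smul_apply,
      smul_eq_mul, h1, h2, LinearMap.domRestrict₁₂_apply]
    refine Eq.congr ?_ rfl
    ring
  unfold normCount
  rw [← Nat.card_sigma]
  exact Nat.card_congr ((e.toEquiv.subtypeEquiv fun p => (hB' p).symm).symm.trans
    (Equiv.subtypeProdEquivSigmaSubtype fun x y => B.domRestrict₁₂ (frameCompl B fun _ : Unit => v)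
      (frameCompl B fun _ : Unit => v) y y = a - σ x * B v v * x))

theorem normCount_of_subsingleton [Subsingleton V] [DecidableEq F] (a : F) :
    normCount B a = if a = 0 then 1 else 0 := by
  have h (x : V) : B x x = 0 := by rw [Subsingleton.elim x 0, map_zero]
  unfold normCount
  split_ifs with ha
  · simp only [h, ha]
    rw [Nat.card_congr (Equiv.subtypeUnivEquiv fun _ => trivial)]
    exact Nat.card_eq_one_iff_unique.2 ⟨inferInstance, ⟨0⟩⟩
  · simp only [h, Ne.symm ha]
    exact Nat.card_of_isEmpty

/-- The number of vectors pairing to `1` with a given nonzero vector. -/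
theorem card_mul_card_apply_eq_one [Fintype F] [Finite V] (hN : B.Nondegenerate) {u : V} (hu : u ≠ 0) :
    Fintype.card F * Nat.card {w : V // B u w = 1} = Nat.card V := by
  have : Module.Finite F V := Module.Finite.of_finite
  obtain ⟨w, hw⟩ := hN.exists_apply_eq_one hu
  have hk : Nat.card {w : V // B u w = 1} = Nat.card (LinearMap.ker (B u)) := by
    refine Nat.card_congr ((Equiv.subRight w).subtypeEquiv fun x => ?_)
    rw [LinearMap.mem_ker, Equiv.subRight_apply, map_sub, hw, sub_eq_zero]
  have hf : Module.finrank F (LinearMap.range (B u)) = 1 := by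
    rw [LinearMap.range_eq_top.2 fun t => ⟨t • w, by rw [map_smul, hw, smul_eq_mul, mul_one]⟩,
      finrank_top, Module.finrank_self]
  have := LinearMap.finrank_range_add_finrank_ker (B u)
  rw [hk, Module.natCard_eq_pow_finrank (K := F), Module.natCard_eq_pow_finrank (K := F) (V := V),
    ← this, hf, pow_add, pow_one, Nat.card_eq_fintype_card]

namespace FormCase

variable {F₀ : Type*} [Field F₀] [Algebra F₀ F] {c : FormCase}

/-- If all norms vanish, polarization gives B(x, y) + B(y, x) = 0. A pair with B(u, w) = 1 then
yields 2 = 0 in the symmetric case. In the Hermitian case it yields t + σ(t) = 0 for all t; t = 1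
gives 2 = 0, whence σ is the identity. -/
theorem IsForm.exists_apply_self_ne_zero (hB : c.IsForm F₀ σ B) (hc : c ≠ alternating)
    (hN : B.Nondegenerate) [Nontrivial V] : ∃ v, B v v ≠ 0 := by
  by_contra! h
  have hadd (x y : V) : B x y + B y x = 0 := by
    have := h (x + y)
    simpa [h] using this
  obtain ⟨u, hu⟩ := exists_ne (0 : V)
  obtain ⟨w, hw⟩ := hN.exists_apply_eq_one hu
  cases c with
  | alternating => exact hc rfl
  | symmetric =>
    obtain ⟨-, h2, -, hs⟩ := hB
    have := hadd u w
    rw [hs w u, hw, one_add_one_eq_two] at this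
    exact (Ring.two_ne_zero h2) this
  | hermitian =>
    obtain ⟨-, -, h1, hs⟩ := hB
    have ht (t : F) : t + σ t = 0 := by
      have := hadd u (t • w)
      rwa [← hs u (t • w), map_smul, hw, smul_eq_mul, mul_one] at this
    have h2 := ht 1
    rw [map_one] at h2
    refine h1 (RingHom.ext fun t => ?_)
    rw [RingHom.id_apply]
    linear_combination ht t - t * h2

variable [Fintype F] [DecidableEq F] {r : ℕ} {χ : ℤ}

theorem HasType.eq_one_of_zero (h : c.HasType B 0 χ) : χ = 1 := by
  obtain ⟨-, b, rfl⟩ := h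
  have : IsEmpty (Fin (c.gamma * 0)) := by rw [mul_zero]; infer_instance
  rw [Matrix.det_isEmpty, sign_one]

theorem HasType.subsingleton [Finite V] (h : c.HasType B 0 χ) : Subsingleton V := by
  have : Module.Finite F V := Module.Finite.of_finite
  exact Module.finrank_zero_iff.1 h.finrank_eq

theorem HasType.nontrivial (h : c.HasType B (r + 1) χ) : Nontrivial V := by
  refine Module.nontrivial_of_finrank_pos (R := F) ?_
  rw [h.finrank_eq]
  exact Nat.mul_pos c.gamma_pos r.succ_pos

variable [Finite V]

theorem hasType_frameCompl_single (hB : c.IsForm F₀ σ B) (h : c.HasType B (r + 1) χ)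
    (hc : c.gamma = 1) (hv : B v v ≠ 0) :
    c.HasType (B.domRestrict₁₂ (frameCompl B fun _ : Unit => v) (frameCompl B fun _ : Unit => v)) r
      (χ * c.sign F (B v v)) := by
  have : Module.Finite F V := Module.Finite.of_finite
  have h1 := (hasType_frameCompl hB h (single_mem_gramFrames (v := v))
    (by rwa [det_singleGram]) (n := 1) (by rw [hc]; rfl)).2
  rwa [det_singleGram] at h1

/-- The deviation of `q` times the number of vectors of norm `a` from `q ^ r`. -/
def symmDev (F : Type*) [Field F] [Fintype F] [DecidableEq F] (r : ℕ) (χ : ℤ) (a : F) : ℤ :=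
  if Even r then
    Fintype.card F ^ (r / 2) * quadraticChar F (-1) ^ (r / 2) * χ * zeroDev (Fintype.card F) a
  else Fintype.card F ^ (r / 2 + 1) * quadraticChar F (-1) ^ (r / 2) * χ * quadraticChar F a

/-- The inductive step of the symmetric count. Summing over the values dx² turns a deviation
supported by `zeroDev` (even rank) into a multiple of the quadratic character (odd rank), and back
by the Jacobi sum. -/
theorem sum_symmDev (hF : ringChar F ≠ 2) {d : F} (hd : d ≠ 0) (r : ℕ) (χ : ℤ) (a : F) :
    ∑ x : F, symmDev F r (χ * quadraticChar F d) (a - x * d * x) = symmDev F (r + 1) χ a := by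
  have h0 : ∑ y : F, quadraticChar F (a - y) = 0 := by
    rw [← quadraticChar_sum_zero hF]
    exact Fintype.sum_equiv (Equiv.subLeft a) _ _ fun y => rfl
  have hd2 := quadraticChar_sq_one hd
  rw [sum_comp_mul_sq hF hd fun y => symmDev F r (χ * quadraticChar F d) (a - y)]
  rcases Nat.even_or_odd' r with ⟨s, rfl | rfl⟩
  · have h1 : ∑ y : F, zeroDev (Fintype.card F) (a - y) * (1 + quadraticChar F (d * y)) =
        Fintype.card F * (quadraticChar F d * quadraticChar F a) := by
      simp only [mul_add, mul_one, Finset.sum_add_distrib, sum_zeroDev_sub, map_mul, zero_add]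
      simp only [zeroDev_eq, sub_mul, one_mul, Finset.sum_sub_distrib, ← Finset.mul_sum,
        quadraticChar_sum_zero hF, mul_zero, sub_zero, sub_eq_zero, mul_assoc]
      simp
    simp only [symmDev, even_two_mul, if_true, show ¬ Even (2 * s + 1) by simp, if_false, mul_assoc,
      ← Finset.mul_sum, h1, show 2 * s / 2 = s by omega, show (2 * s + 1) / 2 = s by omega]
    linear_combination ((Fintype.card F : ℤ) ^ (s + 1) * quadraticChar F (-1) ^ s * χ *
      quadraticChar F a) * hd2
  · have h1 : ∑ y : F, quadraticChar F (a - y) * (1 + quadraticChar F (d * y)) =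
        quadraticChar F d * (quadraticChar F (-1) * zeroDev (Fintype.card F) a) := by
      rw [← sum_quadraticChar_mul_sub hF, Finset.mul_sum]
      simp only [mul_add, mul_one, Finset.sum_add_distrib, h0, map_mul, zero_add]
      exact Finset.sum_congr rfl fun y _ => by ring
    simp only [symmDev, show ¬ Even (2 * s + 1) by simp, if_false, mul_assoc,
      show Even (2 * s + 1 + 1) by simp [parity_simps], if_true,
      ← Finset.mul_sum, h1, show (2 * s + 1 + 1) / 2 = s + 1 by omega,
      show (2 * s + 1) / 2 = s by omega]
    linear_combination ((Fintype.card F : ℤ) ^ (s + 1) * quadraticChar F (-1) ^ (s + 1) * χ *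
      zeroDev (Fintype.card F) a) * hd2

theorem card_mul_normCount_symmetric (hB : symmetric.IsForm F₀ σ B)
    (h : symmetric.HasType B r χ) (a : F) :
    (Fintype.card F * normCount B a : ℤ) = Fintype.card F ^ r + symmDev F r χ a := by
  induction r generalizing V χ a with
  | zero =>
    have := h.subsingleton
    obtain rfl := h.eq_one_of_zero
    rw [normCount_of_subsingleton]
    simp only [symmDev, zeroDev]
    split_ifs <;> simp_all
  | succ r ih =>
    have := h.nontrivial
    obtain ⟨v, hv⟩ := hB.exists_apply_self_ne_zero (by simp) h.1
    have hW := hasType_frameCompl_single hB h rfl hv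
    have hσ (x : F) : σ x = x := by rw [hB.2.2.1]; rfl
    rw [normCount_eq_sum hB.isRefl hv, Nat.cast_sum, Finset.mul_sum,
      Finset.sum_congr rfl fun x _ => ih (hB.restrict _) hW _, Finset.sum_add_distrib,
      ← sum_symmDev hB.2.1 hv]
    simp [pow_succ', sign, hσ]

theorem card_mul_normCount_hermitian [Fintype F₀] [DecidableEq F₀] (hB : hermitian.IsForm F₀ σ B)
    (h : hermitian.HasType B r χ) (a : F₀) :
    (Fintype.card F₀ * normCount B (algebraMap F₀ F a) : ℤ) =
      Fintype.card F₀ ^ (2 * r) + (-Fintype.card F₀) ^ r * zeroDev (Fintype.card F₀) a := by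
  induction r generalizing V χ a with
  | zero =>
    have := h.subsingleton
    rw [normCount_of_subsingleton]
    simp only [zeroDev]
    split_ifs <;> simp_all
  | succ r ih =>
    have := h.nontrivial
    obtain ⟨v, hv⟩ := hB.exists_apply_self_ne_zero (by simp) h.1
    have hW := hasType_frameCompl_single hB h rfl hv
    obtain ⟨h2, hσ, h1, hs⟩ := id hB
    -- Norms of vectors are fixed by σ, so they lie in F₀.
    obtain ⟨d, hd⟩ := exists_algebraMap_eq h2 hσ h1 (hs v v)
    have hd0 : d ≠ 0 := by rintro rfl; exact hv (by rw [← hd, map_zero])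
    have hx (x : F) : algebraMap F₀ F a - σ x * B v v * x =
        algebraMap F₀ F (a - d * Algebra.norm F₀ x) := by
      rw [map_sub, map_mul, algebraMap_norm_eq_mul h2 hσ h1, hd]; ring
    rw [normCount_eq_sum hB.isRefl hv, Nat.cast_sum, Finset.mul_sum,
      Finset.sum_congr rfl fun x _ => by rw [hx x, ih (hB.restrict _) hW _],
      Finset.sum_add_distrib, ← Finset.mul_sum, sum_zeroDev_norm h2 hd0]
    simp [card_eq_sq h2]
    ring

end FormCase

end NormCount

/-! ### Orders of the isometry groups as rational numbers. -/

section Orders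

theorem qFalling_zero (x : ℚ) : qFalling x 0 = 1 := by simp [qFalling]

theorem qFalling_succ (x : ℚ) (n : ℕ) : qFalling x (n + 1) = qFalling x n * (x ^ (n + 1) - 1) := by
  rw [qFalling, qFalling, Finset.prod_Icc_succ_top (by omega)]

theorem qFalling_ne_zero {x : ℚ} (hx : 1 < |x|) (n : ℕ) : qFalling x n ≠ 0 := by
  rw [qFalling, Finset.prod_ne_zero_iff]
  intro i hi h
  have h1 : |x| ^ i = 1 := by rw [← abs_pow, sub_eq_zero.1 h, abs_one]
  exact (one_lt_pow₀ hx (by have := Finset.mem_Icc.1 hi; omega)).ne' h1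

/-- The order of the isometry group of a space of type `(r, χ)`. -/
def isomOrder (c : FormCase) (q₀ q : ℕ) (ε : ℤ) (r : ℕ) (χ : ℤ) : ℚ :=
  match c with
  | FormCase.hermitian =>
      (-1) ^ r * (-(q₀ : ℚ)) ^ r.choose 2 * qFalling (-(q₀ : ℚ)) r
  | FormCase.symmetric =>
      2 * (q : ℚ) ^ ((r / 2).choose 2 + ((r + 1) / 2).choose 2) * qFalling ((q : ℚ) ^ 2) (r / 2) /
        eFactor q ε r χ
  | FormCase.alternating => (q : ℚ) ^ (r ^ 2) * qFalling ((q : ℚ) ^ 2) r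

theorem eFactor_even (q : ℕ) (ε : ℤ) (s : ℕ) (χ : ℤ) :
    eFactor q ε (2 * s) χ = (q : ℚ) ^ s + (ε : ℚ) ^ s * χ := by
  rw [eFactor, if_pos (even_two_mul s), Nat.mul_div_cancel_left _ two_pos]

theorem eFactor_odd (q : ℕ) (ε : ℤ) (s : ℕ) (χ : ℤ) : eFactor q ε (2 * s + 1) χ = 1 := by
  rw [eFactor, if_neg (by simp)]

theorem isomOrder_even (q₀ q : ℕ) (ε : ℤ) (s : ℕ) (χ : ℤ) :
    isomOrder .symmetric q₀ q ε (2 * s) χ = 2 * (q : ℚ) ^ (s.choose 2 + s.choose 2) *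
      qFalling ((q : ℚ) ^ 2) s / ((q : ℚ) ^ s + (ε : ℚ) ^ s * χ) := by
  rw [isomOrder, eFactor_even, show 2 * s / 2 = s by omega, show (2 * s + 1) / 2 = s by omega]

theorem isomOrder_odd (q₀ q : ℕ) (ε : ℤ) (s : ℕ) (χ : ℤ) :
    isomOrder .symmetric q₀ q ε (2 * s + 1) χ = 2 * (q : ℚ) ^ (s.choose 2 + (s.choose 2 + s)) *
      qFalling ((q : ℚ) ^ 2) s := by
  rw [isomOrder, eFactor_odd, show (2 * s + 1) / 2 = s by omega,
    show (2 * s + 1 + 1) / 2 = s + 1 by omega, div_one, Nat.choose_succ_succ' s 1,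
    Nat.choose_one_right, add_comm s]

/-- Vanishing for r = 2s would mean q^s = -ε^s χ, of square 1, hence s = 0 and χ = -1. -/
theorem eFactor_ne_zero {q : ℕ} (hq : 1 < q) {ε χ : ℤ} (hε : ε ^ 2 = 1) (hχ : χ ^ 2 = 1) {r : ℕ}
    (h : 0 < r ∨ χ = 1) : eFactor q ε r χ ≠ 0 := by
  rcases Nat.even_or_odd' r with ⟨s, rfl | rfl⟩
  · rw [eFactor_even]
    intro h0
    rcases Nat.eq_zero_or_pos s with rfl | hs
    · obtain rfl : χ = 1 := by omega
      norm_num at h0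
    · have hε' : (ε : ℚ) ^ 2 = 1 := by exact_mod_cast hε
      have hχ' : (χ : ℚ) ^ 2 = 1 := by exact_mod_cast hχ
      have h1 : ((q : ℚ) ^ s) ^ 2 = 1 := by
        rw [eq_neg_of_add_eq_zero_left h0, neg_sq, mul_pow, hχ', pow_right_comm, hε', one_pow,
          one_mul]
      have h2 : 1 < ((q : ℚ) ^ s) ^ 2 :=
        one_lt_pow₀ (one_lt_pow₀ (by exact_mod_cast hq) hs.ne') two_ne_zero
      exact h2.ne' h1
  · rw [eFactor_odd]; exact one_ne_zero

theorem isomOrder_ne_zero (c : FormCase) {q₀ q : ℕ} (hq₀ : 1 < q₀) (hq : 1 < q) {ε χ : ℤ}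
    (hε : ε ^ 2 = 1) (hχ : χ ^ 2 = 1) {r : ℕ} (h : 0 < r ∨ χ = 1) :
    isomOrder c q₀ q ε r χ ≠ 0 := by
  have h1 : (1 : ℚ) < q₀ := by exact_mod_cast hq₀
  have h2 : (1 : ℚ) < q := by exact_mod_cast hq
  have h3 : 1 < |(q : ℚ) ^ 2| := by
    rw [abs_of_pos (by positivity)]; exact one_lt_pow₀ h2 two_ne_zero
  have h4 : (q : ℚ) ≠ 0 := by positivity
  have h5 : (q₀ : ℚ) ≠ 0 := by positivity
  cases c with
  | hermitian =>
    refine mul_ne_zero (mul_ne_zero ?_ (pow_ne_zero _ (neg_ne_zero.2 h5))) (qFalling_ne_zero ?_ _)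
    · simp
    · rwa [abs_neg, abs_of_pos (by positivity)]
  | symmetric =>
    exact div_ne_zero (mul_ne_zero (mul_ne_zero two_ne_zero (pow_ne_zero _ h4))
      (qFalling_ne_zero h3 _)) (eFactor_ne_zero hq hε hχ h)
  | alternating => exact mul_ne_zero (pow_ne_zero _ h4) (qFalling_ne_zero h3 _)

theorem isomOrder_zero_one (c : FormCase) (q₀ q : ℕ) (ε : ℤ) : isomOrder c q₀ q ε 0 1 = 1 := by
  cases c <;> norm_num [isomOrder, qFalling_zero, eFactor]

/-- The telescoping step for products of indices. The middle order may be 0, but only for s = 0;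
then `h` makes the last type equal to the middle one, and both sides are 0. -/
theorem isomOrder_inv_mul_cancel (c : FormCase) {q₀ q : ℕ} (hq₀ : 1 < q₀) (hq : 1 < q)
    {ε χ χ' : ℤ} (hε : ε ^ 2 = 1) (hχ : χ ^ 2 = 1) {s t : ℕ} (h : s = 0 → t = 0 ∧ χ = χ') :
    (isomOrder c q₀ q ε s χ)⁻¹ * (isomOrder c q₀ q ε s χ * (isomOrder c q₀ q ε t χ')⁻¹) =
      (isomOrder c q₀ q ε t χ')⁻¹ := by
  by_cases h0 : isomOrder c q₀ q ε s χ = 0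
  · have hs : s = 0 := by
      by_contra hs
      exact isomOrder_ne_zero c hq₀ hq hε hχ (Or.inl (Nat.pos_of_ne_zero hs)) h0
    obtain ⟨rfl, rfl⟩ := h hs
    subst hs
    simp [h0]
  · rw [inv_mul_cancel_left₀ h0]

end Orders

/-! ### Ratios of consecutive orders. -/

section RatioIdentities

variable {q₀ q : ℕ} {ε χ : ℤ}

theorem isomOrder_hermitian_ratio (hq₀ : 1 < q₀) (r : ℕ) (ψ : ℤ) :
    isomOrder .hermitian q₀ q ε (r + 1) χ * (isomOrder .hermitian q₀ q ε r ψ)⁻¹ =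
      -(-(q₀ : ℚ)) ^ r * ((-(q₀ : ℚ)) ^ (r + 1) - 1) := by
  have h1 : (1 : ℚ) < q₀ := by exact_mod_cast hq₀
  have hx : -(q₀ : ℚ) ≠ 0 := by linarith
  have hf : qFalling (-(q₀ : ℚ)) r ≠ 0 :=
    qFalling_ne_zero (by rwa [abs_neg, abs_of_pos (by positivity)]) r
  simp only [isomOrder, qFalling_succ, Nat.choose_succ_succ' r 1, Nat.choose_one_right]
  generalize -(q₀ : ℚ) = x at *
  have h3 : ((-1 : ℚ)) ^ r ≠ 0 := by simp
  field_simp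
  ring

theorem isomOrder_alternating_ratio (hq : 1 < q) (r : ℕ) (ψ : ℤ) :
    isomOrder .alternating q₀ q ε (r + 1) χ * (isomOrder .alternating q₀ q ε r ψ)⁻¹ =
      (q : ℚ) ^ (2 * r + 1) * ((q : ℚ) ^ (2 * r + 2) - 1) := by
  have h1 : (1 : ℚ) < q := by exact_mod_cast hq
  have hx : (q : ℚ) ≠ 0 := by positivity
  have hf : qFalling ((q : ℚ) ^ 2) r ≠ 0 :=
    qFalling_ne_zero (by rw [abs_of_pos (by positivity)]; exact one_lt_pow₀ h1 two_ne_zero) r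
  simp only [isomOrder, qFalling_succ]
  field_simp
  ring

/-- This remains true for s = 0, ψ = -1, where the inverse of 0 is 0 and so is the right side. -/
theorem isomOrder_odd_even_ratio (hq : 1 < q) (s : ℕ) (ψ : ℤ) :
    isomOrder .symmetric q₀ q ε (2 * s + 1) χ * (isomOrder .symmetric q₀ q ε (2 * s) ψ)⁻¹ =
      (q : ℚ) ^ s * ((q : ℚ) ^ s + (ε : ℚ) ^ s * ψ) := by
  have h1 : (1 : ℚ) < q := by exact_mod_cast hq
  have hx : (q : ℚ) ≠ 0 := by positivity
  have hf : qFalling ((q : ℚ) ^ 2) s ≠ 0 :=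
    qFalling_ne_zero (by rw [abs_of_pos (by positivity)]; exact one_lt_pow₀ h1 two_ne_zero) s
  rw [isomOrder_odd, isomOrder_even, inv_div]
  field_simp
  ring

/-- With e = ε^(s+1) χ, e² = 1, the new factor q^(2s+2) - 1 splits as (q^(s+1) - e)(q^(s+1) + e),
and `eFactor` cancels the second half. -/
theorem isomOrder_even_odd_ratio (hq : 1 < q) (hε : ε ^ 2 = 1) (hχ : χ ^ 2 = 1) (s : ℕ) (ψ : ℤ) :
    isomOrder .symmetric q₀ q ε (2 * s + 2) χ * (isomOrder .symmetric q₀ q ε (2 * s + 1) ψ)⁻¹ =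
      (q : ℚ) ^ s * ((q : ℚ) ^ (s + 1) - (ε : ℚ) ^ (s + 1) * χ) := by
  have h1 : (1 : ℚ) < q := by exact_mod_cast hq
  have hx : (q : ℚ) ≠ 0 := by positivity
  have hf : qFalling ((q : ℚ) ^ 2) s ≠ 0 :=
    qFalling_ne_zero (by rw [abs_of_pos (by positivity)]; exact one_lt_pow₀ h1 two_ne_zero) s
  have he := eFactor_ne_zero hq hε hχ (r := 2 * (s + 1)) (Or.inl (by omega))
  have hε' : (ε : ℚ) ^ 2 = 1 := by exact_mod_cast hε
  have hχ' : (χ : ℚ) ^ 2 = 1 := by exact_mod_cast hχ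
  have hsq : ((ε : ℚ) ^ (s + 1) * χ) ^ 2 = 1 := by
    rw [mul_pow, hχ', pow_right_comm, hε', one_pow, one_mul]
  rw [eFactor_even] at he
  rw [show 2 * s + 2 = 2 * (s + 1) by ring, isomOrder_odd, isomOrder_even, qFalling_succ,
    Nat.choose_succ_succ' s 1, Nat.choose_one_right]
  generalize (ε : ℚ) ^ (s + 1) * χ = e at *
  rw [div_mul_eq_mul_div, div_eq_iff he]
  field_simp
  have h : ((q : ℚ) ^ 2) ^ (s + 1) = ((q : ℚ) ^ (s + 1)) ^ 2 := pow_right_comm _ _ _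
  rw [h]
  linear_combination ((q : ℚ) ^ (2 * s + 2 * s.choose 2)) * hsq

end RatioIdentities

/-! ### Vector and isotropic frame counts as ratios of orders. -/

section VectorCounts

set_option linter.unusedSectionVars false

universe u

namespace FormCase

variable {F₀ F : Type*} {V : Type u} [Field F₀] [Field F] [Fintype F₀] [Fintype F] [DecidableEq F]
  [Algebra F₀ F] [AddCommGroup V] [Module F V] {c : FormCase} {σ : F →+* F}
  {B : V →ₛₗ[σ] V →ₗ[F] F} {r : ℕ} {χ : ℤ}

theorem sign_neg_one_sq (c : FormCase) : c.sign F (-1) ^ 2 = 1 := by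
  rw [sq, sign_mul_self c (neg_ne_zero.2 one_ne_zero)]

theorem HasType.sq_eq_one (hB : B.IsRefl) (h : c.HasType B r χ) : χ ^ 2 = 1 := by
  obtain ⟨a, ha, rfl⟩ := h.exists_ne_zero hB
  rw [sq, sign_mul_self c ha]

variable (F₀ F) in
/-- The order of the isometry group of a space of type `(r, χ)` over `F`. -/
abbrev formOrder (c : FormCase) (r : ℕ) (χ : ℤ) : ℚ :=
  isomOrder c (Fintype.card F₀) (Fintype.card F) (c.sign F (-1)) r χ

variable (F) in
theorem one_lt_cast_card : (1 : ℚ) < Fintype.card F := by exact_mod_cast Fintype.one_lt_card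

variable [Finite V]

theorem normCount_symmetric (hB : symmetric.IsForm F₀ σ B) (h : symmetric.HasType B (r + 1) χ)
    {a : F} (ha : a ≠ 0) : (normCount B a : ℚ) = formOrder F₀ F symmetric (r + 1) χ *
      (formOrder F₀ F symmetric r (χ * symmetric.sign F a))⁻¹ := by
  have h0 : (Fintype.card F : ℚ) ≠ 0 := (zero_lt_one.trans (one_lt_cast_card F)).ne'
  have h1 : (Fintype.card F * normCount B a : ℚ) =
      Fintype.card F ^ (r + 1) + (symmDev F (r + 1) χ a : ℤ) := by
    exact_mod_cast card_mul_normCount_symmetric hB h a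
  refine mul_left_cancel₀ h0 (h1.trans ?_)
  rcases Nat.even_or_odd' r with ⟨s, rfl | rfl⟩
  · rw [formOrder, formOrder, isomOrder_odd_even_ratio Fintype.one_lt_card, symmDev,
      if_neg (by simp), show (2 * s + 1) / 2 = s by omega]
    push_cast [sign]
    ring
  · rw [formOrder, formOrder, isomOrder_even_odd_ratio Fintype.one_lt_card (sign_neg_one_sq _)
      (h.sq_eq_one hB.isRefl), symmDev, if_pos (by simp [parity_simps]),
      show (2 * s + 1 + 1) / 2 = s + 1 by omega, zeroDev, if_neg ha]
    push_cast [sign]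
    ring

theorem normCount_hermitian (hB : hermitian.IsForm F₀ σ B) (h : hermitian.HasType B (r + 1) χ)
    (ψ : ℤ) : (normCount B 1 : ℚ) = formOrder F₀ F hermitian (r + 1) χ *
      (formOrder F₀ F hermitian r ψ)⁻¹ := by
  classical
  have h0 : (Fintype.card F₀ : ℚ) ≠ 0 := (zero_lt_one.trans (one_lt_cast_card F₀)).ne'
  have h1 : (Fintype.card F₀ * normCount B (1 : F) : ℚ) = Fintype.card F₀ ^ (2 * (r + 1)) +
      (-Fintype.card F₀) ^ (r + 1) * (zeroDev (Fintype.card F₀) (1 : F₀) : ℤ) := by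
    have := card_mul_normCount_hermitian hB h (1 : F₀)
    rw [map_one] at this
    exact_mod_cast this
  refine mul_left_cancel₀ h0 (h1.trans ?_)
  rw [formOrder, formOrder, isomOrder_hermitian_ratio Fintype.one_lt_card, zeroDev,
    if_neg one_ne_zero]
  have h2 : (Fintype.card F₀ : ℚ) ^ (2 * (r + 1)) = (-(Fintype.card F₀ : ℚ)) ^ (2 * (r + 1)) := by
    rw [pow_mul, pow_mul, neg_sq]
  rw [h2]
  push_cast
  ring

theorem card_isoVectors_add_one : Nat.card (isoVectors B) + 1 = normCount B 0 := by
  have h : normCount B 0 = Nat.card ((insert 0 (isoVectors B) : Set V)) := by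
    refine Nat.card_congr (Equiv.setCongr (s := {x | B x x = 0}) (t := insert 0 (isoVectors B)) ?_)
    ext x
    by_cases hx : x = 0 <;> simp [isoVectors, hx]
  rw [h, Nat.card_coe_set_eq, Nat.card_coe_set_eq, Set.ncard_insert_of_notMem]
  exact fun h => h.1 rfl

/-- The order of the unipotent part of the stabilizer of an isotropic vector. -/
def isoStab (c : FormCase) (q₀ q : ℕ) (r : ℕ) : ℚ :=
  match c with
  | hermitian => (q₀ : ℚ) ^ (2 * r + 1)
  | symmetric => (q : ℚ) ^ r
  | alternating => (q : ℚ) ^ (2 * r + 1)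

theorem card_isoVectors_symmetric (hB : symmetric.IsForm F₀ σ B)
    (h : symmetric.HasType B (r + 2) χ) :
    (Nat.card (isoVectors B) : ℚ) = formOrder F₀ F symmetric (r + 2) χ *
      (formOrder F₀ F symmetric r (χ * symmetric.sign F (-1)))⁻¹ / Fintype.card F ^ r := by
  have h0 : (Fintype.card F : ℚ) ≠ 0 := (zero_lt_one.trans (one_lt_cast_card F)).ne'
  have hε := sign_neg_one_sq (F := F) symmetric
  have hχ := h.sq_eq_one hB.isRefl
  have h1 : (Fintype.card F * (Nat.card (isoVectors B) + 1) : ℚ) =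
      Fintype.card F ^ (r + 2) + (symmDev F (r + 2) χ 0 : ℤ) := by
    have := card_mul_normCount_symmetric hB h 0
    rw [← card_isoVectors_add_one] at this
    exact_mod_cast this
  -- The order of type (r + 1, χ), nonzero because r + 1 > 0, is inserted to split the ratio into
  -- two one-step ratios.
  have h2 := isomOrder_inv_mul_cancel symmetric (q₀ := Fintype.card F₀) Fintype.one_lt_card
    (Fintype.one_lt_card (α := F)) hε hχ (s := r + 1) (t := r)
    (χ' := χ * symmetric.sign F (-1)) (by simp)
  have hε' : (quadraticChar F (-1) : ℚ) ^ 2 = 1 := by exact_mod_cast hε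
  have hχ' : (χ : ℚ) ^ 2 = 1 := by exact_mod_cast hχ
  rw [eq_div_iff (pow_ne_zero _ h0), formOrder, formOrder, ← h2, ← mul_assoc]
  refine mul_left_cancel₀ h0 ?_
  rw [← mul_assoc, eq_sub_of_add_eq ((mul_add_one _ _).symm.trans h1)]
  have hsq (s : ℕ) : ((quadraticChar F (-1) : ℚ) ^ s * χ) ^ 2 = 1 := by
    rw [mul_pow, hχ', pow_right_comm, hε', one_pow, one_mul]
  rcases Nat.even_or_odd' r with ⟨s, rfl | rfl⟩
  · rw [isomOrder_even_odd_ratio Fintype.one_lt_card hε hχ,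
      isomOrder_odd_even_ratio Fintype.one_lt_card, symmDev, if_pos (by simp [parity_simps]),
      show (2 * s + 2) / 2 = s + 1 by omega, zeroDev, if_pos rfl]
    push_cast [sign]
    linear_combination ((Fintype.card F : ℚ) ^ (2 * s + 1)) * hsq (s + 1)
  · rw [isomOrder_even_odd_ratio Fintype.one_lt_card hε hχ (s := s),
      show 2 * s + 1 + 2 = 2 * (s + 1) + 1 by ring, show 2 * s + 1 + 1 = 2 * (s + 1) by ring,
      isomOrder_odd_even_ratio Fintype.one_lt_card, symmDev, if_neg (by simp)]
    push_cast [sign, quadraticChar_zero]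
    linear_combination ((Fintype.card F : ℚ) ^ (2 * s + 2)) * hsq (s + 1)

theorem card_isoVectors_hermitian (hB : hermitian.IsForm F₀ σ B)
    (h : hermitian.HasType B (r + 2) χ) (ψ : ℤ) :
    (Nat.card (isoVectors B) : ℚ) = formOrder F₀ F hermitian (r + 2) χ *
      (formOrder F₀ F hermitian r ψ)⁻¹ / Fintype.card F₀ ^ (2 * r + 1) := by
  classical
  have h0 : (Fintype.card F₀ : ℚ) ≠ 0 := (zero_lt_one.trans (one_lt_cast_card F₀)).ne'
  have h1 : (Fintype.card F₀ * (Nat.card (isoVectors B) + 1) : ℚ) = Fintype.card F₀ ^ (2 * (r + 2)) +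
      (-Fintype.card F₀) ^ (r + 2) * (zeroDev (Fintype.card F₀) (0 : F₀) : ℤ) := by
    have := card_mul_normCount_hermitian hB h (0 : F₀)
    rw [map_zero, ← card_isoVectors_add_one] at this
    exact_mod_cast this
  have h2 := isomOrder_inv_mul_cancel hermitian (q₀ := Fintype.card F₀) Fintype.one_lt_card
    (Fintype.one_lt_card (α := F)) (sign_neg_one_sq (F := F) hermitian) (h.sq_eq_one hB.isRefl) (s := r + 1) (t := r)
    (χ' := ψ) (by simp)
  rw [eq_div_iff (pow_ne_zero _ h0), formOrder, formOrder, ← h2, ← mul_assoc,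
    isomOrder_hermitian_ratio Fintype.one_lt_card, isomOrder_hermitian_ratio Fintype.one_lt_card]
  refine mul_left_cancel₀ h0 ?_
  rw [← mul_assoc, eq_sub_of_add_eq ((mul_add_one _ _).symm.trans h1), zeroDev, if_pos rfl]
  push_cast
  have hx : (Fintype.card F₀ : ℚ) = - -(Fintype.card F₀ : ℚ) := (neg_neg _).symm
  generalize -(Fintype.card F₀ : ℚ) = x at *
  rw [hx]
  have h3 (k : ℕ) : (-x) ^ (2 * k) = x ^ (2 * k) := by rw [pow_mul, pow_mul, neg_sq]
  rw [pow_succ (-x), h3, h3]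
  ring

theorem card_isoVectors_alternating (hB : alternating.IsForm F₀ σ B)
    (h : alternating.HasType B (r + 1) χ) (ψ : ℤ) :
    (Nat.card (isoVectors B) : ℚ) = formOrder F₀ F alternating (r + 1) χ *
      (formOrder F₀ F alternating r ψ)⁻¹ / Fintype.card F ^ (2 * r + 1) := by
  have h0 : (Fintype.card F : ℚ) ≠ 0 := (zero_lt_one.trans (one_lt_cast_card F)).ne'
  have h1 : normCount B 0 = Fintype.card F ^ (2 * r + 2) := by
    have : Module.Finite F V := Module.Finite.of_finite
    rw [normCount, Nat.card_congr (Equiv.subtypeUnivEquiv hB.2.2),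
      Module.natCard_eq_pow_finrank (K := F), h.finrank_eq, Nat.card_eq_fintype_card]
    rfl
  rw [formOrder, formOrder, isomOrder_alternating_ratio Fintype.one_lt_card,
    mul_div_cancel_left₀ _ (pow_ne_zero _ h0), eq_sub_iff_add_eq]
  exact_mod_cast card_isoVectors_add_one.trans h1

variable (c) in
/-- A hyperbolic plane has dimension `γ * (2 / γ)`. -/
theorem card_fin_two_eq : Fintype.card (Fin 2) = c.gamma * (2 / c.gamma) := by cases c <;> rfl

theorem card_isoVectors (hB : c.IsForm F₀ σ B) (h : c.HasType B (r + 2 / c.gamma) χ) :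
    (Nat.card (isoVectors B) : ℚ) = formOrder F₀ F c (r + 2 / c.gamma) χ *
      (formOrder F₀ F c r (χ * c.sign F (-1)))⁻¹ /
        isoStab c (Fintype.card F₀) (Fintype.card F) r := by
  cases c with
  | hermitian => exact card_isoVectors_hermitian hB h _
  | symmetric => exact card_isoVectors_symmetric hB h
  | alternating => exact card_isoVectors_alternating hB h _

theorem sign_det_pairGram (hB : c.IsForm F₀ σ B) {u w : V} (hu : B u u = 0) (hw : B u w = 1) :
    c.sign F (pairGram B u w).det = c.sign F (-1) := by
  cases c with
  | hermitian => rfl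
  | symmetric => rw [det_pairGram hu, hB.2.2.2 w u, hw, one_mul]
  | alternating => rfl

theorem hasType_frameCompl_pair (hB : c.IsForm F₀ σ B) (h : c.HasType B r χ) {u w : V}
    (hu : B u u = 0) (hw : B u w = 1) : 2 / c.gamma ≤ r ∧
      c.HasType (B.domRestrict₁₂ (frameCompl B ![u, w]) (frameCompl B ![u, w])) (r - 2 / c.gamma)
        (χ * c.sign F (-1)) := by
  have : Module.Finite F V := Module.Finite.of_finite
  rw [← sign_det_pairGram hB hu hw]
  exact hasType_frameCompl hB h (pair_mem_gramFrames u w) (det_pairGram_ne_zero hB.isRefl hu hw)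
    (card_fin_two_eq c)

/-- The order of the unipotent radical of the stabilizer of an isotropic family. -/
def isoFrameStab (c : FormCase) (q₀ q : ℕ) (l m : ℕ) : ℚ :=
  match c with
  | hermitian => (q₀ : ℚ) ^ (2 * (m * l + m.choose 2) + m)
  | symmetric => (q : ℚ) ^ (m * l + m.choose 2)
  | alternating => (q : ℚ) ^ (2 * m * l + (m + 1).choose 2)

theorem isoFrameStab_zero (q₀ q l : ℕ) : isoFrameStab c q₀ q l 0 = 1 := by
  cases c <;> simp [isoFrameStab]

theorem isoFrameStab_succ (h2 : c = hermitian → Fintype.card F = Fintype.card F₀ ^ 2) (l m : ℕ) :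
    isoFrameStab c (Fintype.card F₀) (Fintype.card F) l (m + 1) * (Fintype.card F : ℚ) ^ m =
      isoStab c (Fintype.card F₀) (Fintype.card F) (l + 2 / c.gamma * m) *
        isoFrameStab c (Fintype.card F₀) (Fintype.card F) l m := by
  cases c with
  | hermitian =>
    simp only [isoFrameStab, isoStab, h2 rfl, gamma, Nat.choose_succ_succ' m 1,
      Nat.choose_one_right]
    push_cast
    ring
  | symmetric =>
    simp only [isoFrameStab, isoStab, gamma, Nat.choose_succ_succ' m 1, Nat.choose_one_right]
    ring
  | alternating =>
    simp only [isoFrameStab, isoStab, gamma, Nat.choose_succ_succ' (m + 1) 1, Nat.choose_one_right]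
    ring

theorem IsForm.card_eq_sq (hB : c.IsForm F₀ σ B) :
    c = hermitian → Fintype.card F = Fintype.card F₀ ^ 2 := by
  rintro rfl
  exact _root_.card_eq_sq hB.1

/-- After the first vector u, the remaining ones amount to m coefficients along u and an isotropic
frame in {u, w}^⊥, whose type is lower by 2/γ with sign changed by ε. The orders telescope and the
powers of the field size combine by `isoFrameStab_succ`. -/
theorem card_isoFrames (hB : c.IsForm F₀ σ B) {l m : ℕ}
    (h : c.HasType B (l + 2 / c.gamma * m) χ) :
    (Nat.card (isoFrames B m) : ℚ) = formOrder F₀ F c (l + 2 / c.gamma * m) χ *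
      (formOrder F₀ F c l (χ * c.sign F (-1) ^ m))⁻¹ /
        isoFrameStab c (Fintype.card F₀) (Fintype.card F) l m := by
  have hq₀ : 1 < Fintype.card F₀ := Fintype.one_lt_card
  have hq : 1 < Fintype.card F := Fintype.one_lt_card
  have hε := sign_neg_one_sq (F := F) c
  induction m generalizing V χ with
  | zero =>
    rw [card_isoFrames_zero, isoFrameStab_zero, div_one, Nat.cast_one, pow_zero, mul_one,
      Nat.mul_zero, Nat.add_zero, mul_inv_cancel₀]
    refine isomOrder_ne_zero c hq₀ hq hε (h.sq_eq_one hB.isRefl) ?_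
    rcases Nat.eq_zero_or_pos l with rfl | hl
    · exact Or.inr h.eq_one_of_zero
    · exact Or.inl hl
  | succ m ih =>
    have hr : l + 2 / c.gamma * (m + 1) = l + 2 / c.gamma * m + 2 / c.gamma := by ring
    rw [hr] at h ⊢
    have hW := fun u w hu hw => ih (hB.restrict _)
      (Nat.add_sub_cancel (l + 2 / c.gamma * m) (2 / c.gamma) ▸
        (hasType_frameCompl_pair hB h (u := u) (w := w) hu hw).2)
    have hχ := h.sq_eq_one hB.isRefl
    have hc := isomOrder_inv_mul_cancel c hq₀ hq hε (χ := χ * c.sign F (-1))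
      (χ' := χ * c.sign F (-1) * c.sign F (-1) ^ m) (by rw [mul_pow, hχ, hε, one_mul])
      (s := l + 2 / c.gamma * m) (t := l) (by
        intro h0
        have h1 : 0 < 2 / c.gamma := by cases c <;> simp [gamma]
        obtain rfl : m = 0 := by
          by_contra hm
          have := Nat.mul_pos h1 (Nat.pos_of_ne_zero hm)
          omega
        exact ⟨by omega, by rw [pow_zero, mul_one]⟩)
    have hs := isoFrameStab_succ hB.card_eq_sq l m
    have hs0 (m) : isoFrameStab c (Fintype.card F₀) (Fintype.card F) l m ≠ 0 := by
      cases c <;> exact pow_ne_zero _ (Nat.cast_ne_zero.2 (by omega))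
    have hs1 : isoStab c (Fintype.card F₀) (Fintype.card F) (l + 2 / c.gamma * m) ≠ 0 := by
      cases c <;> exact pow_ne_zero _ (Nat.cast_ne_zero.2 (by omega))
    rw [card_isoFrames_succ hB.isRefl h.1 hW, card_isoVectors hB h, pow_succ', ← mul_assoc χ,
      Nat.card_eq_fintype_card]
    have key : (Fintype.card F : ℚ) ^ m /
        (isoStab c (Fintype.card F₀) (Fintype.card F) (l + 2 / c.gamma * m) *
          isoFrameStab c (Fintype.card F₀) (Fintype.card F) l m) =
        1 / isoFrameStab c (Fintype.card F₀) (Fintype.card F) l (m + 1) := by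
      rw [div_eq_div_iff (mul_ne_zero hs1 (hs0 _)) (hs0 _), one_mul, ← hs, mul_comm]
    linear_combination (formOrder F₀ F c (l + 2 / c.gamma * m + 2 / c.gamma) χ *
      ((formOrder F₀ F c (l + 2 / c.gamma * m) (χ * c.sign F (-1)))⁻¹ *
      (formOrder F₀ F c (l + 2 / c.gamma * m) (χ * c.sign F (-1)) *
      (formOrder F₀ F c l (χ * c.sign F (-1) * c.sign F (-1) ^ m))⁻¹))) * key +
      (formOrder F₀ F c (l + 2 / c.gamma * m + 2 / c.gamma) χ /
        isoFrameStab c (Fintype.card F₀) (Fintype.card F) l (m + 1)) * hc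

/-- Each isotropic vector uses up a nondegenerate plane, that is 2/γ in the type. -/
theorem card_isoFrames_eq_zero (hB : c.IsForm F₀ σ B) {m : ℕ} (h : c.HasType B r χ)
    (hr : r < 2 / c.gamma * m) : (Nat.card (isoFrames B m) : ℚ) = 0 := by
  induction m generalizing V r χ with
  | zero => exact absurd hr (by simp)
  | succ m ih =>
    rw [card_isoFrames_succ hB.isRefl h.1 (k := 0), mul_zero, mul_zero]
    intro u w hu hw
    obtain ⟨h1, h2⟩ := hasType_frameCompl_pair hB h hu hw
    exact ih (hB.restrict _) h2 (by rw [Nat.mul_succ] at hr; omega)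

end FormCase
end VectorCounts

/-! ### Counting frames with a fixed Gram matrix, and the subspace count. -/

section GramCounts

set_option linter.unusedSectionVars false

universe u

namespace FormCase

variable (F₀ : Type*) {F : Type*} [Field F₀] [Field F] [Fintype F₀] [Fintype F] [DecidableEq F]
  [Algebra F₀ F]

/-- In spaces of type `(r, χ)` the families with Gram matrix `G` are counted by the index of the
isometry group of their orthogonal complement. -/
def WittCount (c : FormCase) (σ : F →+* F) {ι : Type} [Fintype ι] [DecidableEq ι]
    (G : Matrix ι ι F) (n : ℕ) : Prop :=
  ∀ (V : Type u) [AddCommGroup V] [Module F V] [Finite V] (B : V →ₛₗ[σ] V →ₗ[F] F),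
    c.IsForm F₀ σ B → ∀ (r : ℕ) (χ : ℤ), c.HasType B (n + r) χ →
      (Nat.card (gramFrames B G) : ℚ) =
        formOrder F₀ F c (n + r) χ * (formOrder F₀ F c r (χ * c.sign F G.det))⁻¹

theorem card_gramFrames_single {V : Type u} [AddCommGroup V] [Module F V] {σ : F →+* F}
    (B : V →ₛₗ[σ] V →ₗ[F] F) (a : F) :
    Nat.card (gramFrames B (singleGram a)) = normCount B a :=
  Nat.card_congr ((Equiv.funUnique Unit V).subtypeEquiv fun _ => ⟨fun h => h () (), fun h _ _ => h⟩)

/-- The Gram matrix of a symplectic pair. -/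
abbrev symplecticGram (F : Type*) [Field F] : Matrix (Fin 2) (Fin 2) F := !![0, 1; -1, 0]

/-- A symplectic pair is a nonzero vector with a vector pairing to `1` with it. -/
def symplecticPairEquiv {V : Type u} [AddCommGroup V] [Module F V] {σ : F →+* F}
    (B : V →ₛₗ[σ] V →ₗ[F] F) (hB : alternating.IsForm F₀ σ B) :
    gramFrames B (symplecticGram F) ≃ Σ u : isoVectors B, {w : V // B u.1 w = 1} where
  toFun f := ⟨⟨f.1 0, fun h => by
    have h1 : B (f.1 0) (f.1 1) = 1 := f.2 0 1
    rw [h, map_zero, LinearMap.zero_apply] at h1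
    exact zero_ne_one h1, f.2 0 0⟩, ⟨f.1 1, f.2 0 1⟩⟩
  invFun p := ⟨![p.1.1, p.2.1], by
    obtain ⟨⟨u, hu⟩, w, hw⟩ := p
    have h1 : B w u = -1 := by
      have h2 := hB.2.2 (u + w)
      have h3 := hB.2.2 w
      simp only [map_add, LinearMap.add_apply] at h2
      change B u w = 1 at hw
      linear_combination h2 - hu.2 - h3 - hw
    intro i j
    fin_cases i <;> fin_cases j
    · exact hu.2
    · exact hw
    · exact h1
    · exact hB.2.2 w⟩
  left_inv f := by
    refine Subtype.ext (funext fun i => ?_)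
    fin_cases i <;> rfl
  right_inv p := rfl

/-- Each nonzero u has |V|/q = q^(2r+1) partners, exactly the denominator in the isotropic vector
count. -/
theorem wittCount_symplectic (σ : F →+* F) :
    WittCount.{u} F₀ alternating σ (symplecticGram F) 1 := by
  intro V _ _ _ B hB r χ h
  have h0 : (Fintype.card F : ℚ) ≠ 0 := (zero_lt_one.trans (one_lt_cast_card F)).ne'
  rw [add_comm] at h ⊢
  rw [Nat.card_congr (symplecticPairEquiv F₀ B hB), Nat.cast_card_sigma_const
    (k := (Fintype.card F : ℚ) ^ (2 * r + 1)), card_isoVectors_alternating hB h,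
    div_mul_cancel₀ _ (pow_ne_zero _ h0)]
  intro u
  have : Module.Finite F V := Module.Finite.of_finite
  have h1 := card_mul_card_apply_eq_one h.1 u.2.1
  rw [Module.natCard_eq_pow_finrank (K := F) (V := V), h.finrank_eq, Nat.card_eq_fintype_card (α := F),
    show alternating.gamma * (r + 1) = 2 * r + 1 + 1 by simp only [gamma]; ring, pow_succ'] at h1
  rw [Nat.eq_of_mul_eq_mul_left Fintype.card_pos h1, Nat.cast_pow]

theorem exists_wittCount_one (c : FormCase) (σ : F →+* F) (hF : c = symmetric → ringChar F ≠ 2)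
    {ψ : ℤ} (hψ : ψ ∈ c.Sign) : ∃ (ι : Type) (_ : Fintype ι) (_ : DecidableEq ι)
      (G : Matrix ι ι F), Fintype.card ι = c.gamma ∧ G.det ≠ 0 ∧ c.sign F G.det = ψ ∧
        WittCount.{u} F₀ c σ G 1 := by
  cases c with
  | hermitian =>
    obtain rfl : ψ = 1 := hψ
    refine ⟨Unit, inferInstance, inferInstance, singleGram 1, rfl, ?_, rfl, ?_⟩
    · rw [det_singleGram]; exact one_ne_zero
    · intro V _ _ _ B hB r χ h
      rw [add_comm] at h ⊢
      rw [card_gramFrames_single, normCount_hermitian hB h]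
  | symmetric =>
    obtain ⟨a, ha⟩ : ∃ a : F, quadraticChar F a = ψ := by
      rcases hψ with rfl | rfl
      · exact ⟨1, map_one _⟩
      · exact quadraticChar_exists_neg_one (hF rfl)
    have ha0 : a ≠ 0 := by
      rintro rfl
      rw [quadraticChar_zero] at ha
      rcases hψ with rfl | rfl <;> omega
    refine ⟨Unit, inferInstance, inferInstance, singleGram a, rfl, ?_, ?_, ?_⟩
    · rwa [det_singleGram]
    · rw [det_singleGram]; exact ha
    · intro V _ _ _ B hB r χ h
      rw [add_comm] at h ⊢
      rw [card_gramFrames_single, normCount_symmetric hB h ha0, det_singleGram]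
  | alternating =>
    obtain rfl : ψ = 1 := hψ
    refine ⟨Fin 2, inferInstance, inferInstance, symplecticGram F, rfl, ?_, rfl,
      wittCount_symplectic F₀ σ⟩
    simp [Matrix.det_fin_two_of]

/-- The index for G times the index for H inside the complement telescopes through the order of that
complement; `hn` covers the case where this order is 0. -/
theorem WittCount.fromBlocks {c : FormCase} {σ : F →+* F} {ι κ : Type} [Fintype ι] [DecidableEq ι]
    [Fintype κ] [DecidableEq κ] {G : Matrix ι ι F} {H : Matrix κ κ F} {m n : ℕ}
    (hG : WittCount.{u} F₀ c σ G m) (hH : WittCount.{u} F₀ c σ H n) (hdet : G.det ≠ 0)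
    (hι : Fintype.card ι = c.gamma * m) (hn : n = 0 → c.sign F H.det = 1) :
    WittCount.{u} F₀ c σ (Matrix.fromBlocks G 0 0 H) (m + n) := by
  intro V _ _ _ B hB r χ h
  have : Module.Finite F V := Module.Finite.of_finite
  rw [add_assoc] at h ⊢
  have hW (e : gramFrames B G) := (hasType_frameCompl hB h e.2 hdet hι).2
  simp only [Nat.add_sub_cancel_left] at hW
  rw [Nat.card_congr (gramFramesSumEquiv hB.isRefl G H), Nat.cast_card_sigma_const
    fun e => hH _ _ (hB.restrict _) r _ (hW e), hG V B hB _ _ h,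
    Matrix.det_fromBlocks_zero₂₁, sign_mul, mul_assoc, ← mul_assoc χ]
  congr 1
  refine isomOrder_inv_mul_cancel c Fintype.one_lt_card Fintype.one_lt_card (sign_neg_one_sq c) ?_ ?_
  · rw [mul_pow, h.sq_eq_one hB.isRefl, one_mul, sq, sign_mul_self c hdet]
  · intro h0
    rw [hn (by omega), mul_one]
    exact ⟨by omega, rfl⟩

theorem one_mem_sign (c : FormCase) : (1 : ℤ) ∈ c.Sign := by
  cases c <;> simp [Sign]

theorem formOrder_ne_zero {c : FormCase} {V : Type u} [AddCommGroup V] [Module F V] {σ : F →+* F}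
    {B : V →ₛₗ[σ] V →ₗ[F] F} (hB : B.IsRefl) {r : ℕ} {χ : ℤ} (h : c.HasType B r χ) :
    formOrder F₀ F c r χ ≠ 0 := by
  refine isomOrder_ne_zero c Fintype.one_lt_card Fintype.one_lt_card (sign_neg_one_sq c)
    (h.sq_eq_one hB) ?_
  rcases Nat.eq_zero_or_pos r with rfl | hr
  · exact Or.inr h.eq_one_of_zero
  · exact Or.inl hr

theorem exists_wittCount (c : FormCase) (σ : F →+* F) (hF : c = symmetric → ringChar F ≠ 2)
    (n : ℕ) {ψ : ℤ} (hψ : ψ ∈ c.Sign) (hn : n = 0 → ψ = 1) :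
    ∃ (ι : Type) (_ : Fintype ι) (_ : DecidableEq ι) (G : Matrix ι ι F),
      Fintype.card ι = c.gamma * n ∧ G.det ≠ 0 ∧ c.sign F G.det = ψ ∧
        WittCount.{u} F₀ c σ G n := by
  induction n generalizing ψ with
  | zero =>
    obtain rfl := hn rfl
    refine ⟨Fin 0, inferInstance, inferInstance, 1, by simp, by simp, by simp [sign_one], ?_⟩
    intro V _ _ _ B hB r χ h
    have : Unique (gramFrames B (1 : Matrix (Fin 0) (Fin 0) F)) :=
      ⟨⟨⟨Fin.elim0, fun i => i.elim0⟩⟩, fun x => Subtype.ext (Subsingleton.elim _ _)⟩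
    rw [zero_add] at h
    rw [Nat.card_unique, Matrix.det_one, sign_one, mul_one, zero_add, Nat.cast_one,
      mul_inv_cancel₀ (formOrder_ne_zero F₀ hB.isRefl h)]
  | succ n ih =>
    obtain ⟨ι, _, _, G, h1, h2, h3, h4⟩ := exists_wittCount_one F₀ c σ hF hψ
    -- One block carries the whole sign ψ and all the others have sign 1, so a single convenient G
    -- is enough for each type.
    obtain ⟨κ, _, _, H, k1, k2, k3, k4⟩ := ih (one_mem_sign c) fun _ => rfl
    refine ⟨ι ⊕ κ, inferInstance, inferInstance, Matrix.fromBlocks G 0 0 H, ?_, ?_, ?_, ?_⟩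
    · rw [Fintype.card_sum, h1, k1]; ring
    · rw [Matrix.det_fromBlocks_zero₂₁]; exact mul_ne_zero h2 k2
    · rw [Matrix.det_fromBlocks_zero₂₁, sign_mul, h3, k3, mul_one]
    · rw [add_comm]
      exact h4.fromBlocks F₀ k4 h2 (by rw [h1, mul_one]) fun _ => k3

variable {F₀} {V : Type u} [AddCommGroup V] [Module F V] [Finite V] {c : FormCase} {σ : F →+* F}
  {B : V →ₛₗ[σ] V →ₗ[F] F}

/-- For q = |F| this is the order of GL_m(F), the number of bases of the radical. -/
theorem cast_prod_pow_sub_pow (q m : ℕ) (hq : 1 ≤ q) :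
    ((∏ i : Fin m, (q ^ m - q ^ (i : ℕ)) : ℕ) : ℚ) = (q : ℚ) ^ m.choose 2 * qFalling q m := by
  have h1 : ((∏ i : Fin m, (q ^ m - q ^ (i : ℕ)) : ℕ) : ℚ) =
      ∏ i ∈ Finset.range m, ((q : ℚ) ^ m - (q : ℚ) ^ i) := by
    rw [Finset.prod_range, Nat.cast_prod]
    refine Finset.prod_congr rfl fun i _ => ?_
    rw [Nat.cast_sub (Nat.pow_le_pow_right hq i.2.le), Nat.cast_pow, Nat.cast_pow]
  rw [h1]
  clear h1
  induction m with
  | zero => simp [qFalling]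
  | succ m ih =>
    rw [Finset.prod_range_succ', qFalling_succ, Nat.choose_succ_succ' m 1, Nat.choose_one_right]
    simp only [pow_succ' (q : ℚ), pow_zero, ← mul_sub, Finset.prod_mul_distrib, Finset.prod_const,
      Finset.card_range, ih]
    ring

/-- The orbit-stabilizer form of the count of subspaces of given type. -/
theorem card_typedSubspaces_mul (hB : c.IsForm F₀ σ B) {r n m : ℕ} {χ ψ : ℤ} (hn : n ≤ r)
    (h : c.HasType B r χ) (hψ : ψ ∈ c.Sign) (h0 : n = 0 → ψ = 1) :
    (∀ l, r = n + (l + 2 / c.gamma * m) →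
      (Nat.card (TypedSubspaces c B hB.isRefl m n ψ) : ℚ) *
      (formOrder F₀ F c n ψ * Fintype.card F ^ (m * (c.gamma * n)) *
        ((Fintype.card F : ℚ) ^ m.choose 2 * qFalling (Fintype.card F) m)) =
      formOrder F₀ F c r χ * (formOrder F₀ F c l (χ * ψ * c.sign F (-1) ^ m))⁻¹ /
        isoFrameStab c (Fintype.card F₀) (Fintype.card F) l m) ∧
    (r < n + 2 / c.gamma * m → Nat.card (TypedSubspaces c B hB.isRefl m n ψ) = 0) := by
  have : Module.Finite F V := Module.Finite.of_finite
  have hF : c = symmetric → ringChar F ≠ 2 := by rintro rfl; exact hB.2.1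
  obtain ⟨κ, _, _, G, hκ, hG, rfl, hW⟩ := exists_wittCount.{u} F₀ c σ hF n hψ h0
  have hψ2 : (c.sign F G.det) ^ 2 = 1 := by rw [sq, sign_mul_self c hG]
  -- In the quotient G has full size, so the complement has type (0, ψ²) = (0, 1), of order 1, and
  -- the index is the full order.
  have hk (N : TypedSubspaces c B hB.isRefl m n (c.sign F G.det)) :
      (Nat.card (gramFrames (quotientForm B hB.isRefl N.1) G) : ℚ) =
        formOrder F₀ F c n (c.sign F G.det) := by
    have : Finite (N.1 ⧸ (formRadical B N.1).submoduleOf N.1) :=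
      Finite.of_surjective _ (Submodule.mkQ_surjective _)
    rw [hW _ _ (hB.quotient hB.isRefl N.1) 0 _ N.2.2, ← sq, hψ2, formOrder, formOrder,
      isomOrder_zero_one, inv_one, mul_one, Nat.add_zero]
  have hmain := card_mixedFrames hB.isRefl hG hκ hk
  rw [cast_prod_pow_sub_pow _ _ Fintype.card_pos, hκ] at hmain
  obtain ⟨s, rfl⟩ := Nat.exists_eq_add_of_le hn
  have hC (e : gramFrames B G) := (hasType_frameCompl hB h e.2 hG hκ).2
  simp only [Nat.add_sub_cancel_left] at hC
  constructor
  · intro l hl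
    obtain rfl : s = l + 2 / c.gamma * m := by omega
    rw [← hmain, Nat.cast_card_sigma_const fun e => card_isoFrames (hB.restrict _) (hC e),
      hW _ _ hB _ _ h, mul_div_assoc', mul_assoc]
    congr 2
    refine isomOrder_inv_mul_cancel c Fintype.one_lt_card Fintype.one_lt_card (sign_neg_one_sq c)
      ?_ ?_
    · rw [mul_pow, h.sq_eq_one hB.isRefl, hψ2, one_mul]
    · intro h1
      have h2 : 0 < 2 / c.gamma := by cases c <;> simp [gamma]
      obtain rfl : m = 0 := by
        by_contra hm
        have := Nat.mul_pos h2 (Nat.pos_of_ne_zero hm)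
        omega
      exact ⟨by omega, by rw [pow_zero, mul_one]⟩
  · intro hl
    rw [Nat.cast_card_sigma_const fun e => card_isoFrames_eq_zero (hB.restrict _) (hC e) (by omega),
      mul_zero, eq_comm, mul_eq_zero] at hmain
    have h1 : (0 : ℚ) < Fintype.card F := zero_lt_one.trans (one_lt_cast_card F)
    refine Nat.cast_eq_zero.1 (hmain.resolve_right (mul_ne_zero (mul_ne_zero ?_ ?_)
      (mul_ne_zero (pow_ne_zero _ h1.ne') (qFalling_ne_zero ?_ _))))
    · refine isomOrder_ne_zero c Fintype.one_lt_card Fintype.one_lt_card (sign_neg_one_sq c) hψ2 ?_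
      rcases Nat.eq_zero_or_pos n with hn0 | hn0
      · exact Or.inr (h0 hn0)
      · exact Or.inl hn0
    · exact pow_ne_zero _ h1.ne'
    · rw [abs_of_pos h1]; exact one_lt_cast_card F

end FormCase
end GramCounts

/-! ### Matching the ratio of orders with the explicit formula. -/

section Formula

theorem Nat.choose_two_add (a b : ℕ) :
    (a + b).choose 2 = a.choose 2 + b.choose 2 + a * b := by
  induction b with
  | zero => simp
  | succ b ih =>
    rw [← add_assoc, Nat.choose_succ_succ' (a + b) 1, Nat.choose_succ_succ' b 1, ih,
      Nat.choose_one_right, Nat.choose_one_right]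
    ring

theorem Nat.choose_two_double (m : ℕ) : (2 * m).choose 2 = m + 4 * m.choose 2 := by
  have h : m * m = m + 2 * m.choose 2 := by
    induction m with
    | zero => rfl
    | succ m ih =>
      rw [Nat.choose_succ_succ' m 1, Nat.choose_one_right]
      linarith
  rw [two_mul, Nat.choose_two_add, h]
  ring

namespace FormCase

/-- All powers of q₀ become powers of x = -q₀; the remaining signs cancel because their squares are
1. -/
theorem formulaQ_hermitian_mul {q₀ : ℕ} (hq₀ : 1 < q₀) (ε χ ψ₁ ψ₂ : ℤ) (n m l : ℕ) :
    formulaQ hermitian q₀ (q₀ ^ 2) ε (n + (l + 2 * m)) χ n ψ₁ m l ψ₂ *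
      (isomOrder hermitian q₀ (q₀ ^ 2) ε n ψ₁ * ((q₀ ^ 2 : ℕ) : ℚ) ^ (m * (1 * n)) *
        (((q₀ ^ 2 : ℕ) : ℚ) ^ m.choose 2 * qFalling ((q₀ ^ 2 : ℕ) : ℚ) m)) =
      isomOrder hermitian q₀ (q₀ ^ 2) ε (n + (l + 2 * m)) χ *
        (isomOrder hermitian q₀ (q₀ ^ 2) ε l ψ₂)⁻¹ / isoFrameStab hermitian q₀ (q₀ ^ 2) l m := by
  have h1 : (1 : ℚ) < q₀ := by exact_mod_cast hq₀
  have hx : -(q₀ : ℚ) ≠ 0 := by linarith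
  have hf := fun r => qFalling_ne_zero (x := -(q₀ : ℚ))
    (by rwa [abs_neg, abs_of_pos (by positivity)]) r
  have hg : qFalling ((q₀ : ℚ) ^ 2) m ≠ 0 :=
    qFalling_ne_zero (by rw [abs_of_pos (by positivity)]; exact one_lt_pow₀ h1 two_ne_zero) m
  have hs (k : ℕ) : ((-1 : ℚ) ^ k) ^ 2 = 1 := by rw [pow_right_comm, neg_one_sq, one_pow]
  have hn := hs n
  have hl := hs l
  have hm := hs m
  rw [formulaQ, if_neg (by omega)]
  simp only [isomOrder, isoFrameStab, Int.toNat_natCast, Nat.cast_pow, Nat.choose_two_add,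
    Nat.choose_two_double]
  have h2 : (q₀ : ℚ) ^ (2 * (m * l + m.choose 2) + m) =
      (-1) ^ m * (-(q₀ : ℚ)) ^ (2 * (m * l + m.choose 2) + m) := by
    rw [pow_add, pow_mul, pow_add (-(q₀ : ℚ)), pow_mul (-(q₀ : ℚ)), neg_sq, mul_left_comm,
      ← mul_pow (-1), neg_one_mul, neg_neg]
  have h3 : ((-1 : ℚ)) ^ (n + (l + 2 * m)) = (-1) ^ n * (-1) ^ l := by
    rw [pow_add, pow_add, pow_mul, neg_one_sq, one_pow, mul_one]
  rw [h2, h3]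
  have h4 (k : ℕ) : (-1 : ℚ) ^ k ≠ 0 := by simp
  have hl0 := h4 l
  have hm0 := h4 m
  have hq : (q₀ : ℚ) ^ 2 = (-(q₀ : ℚ)) ^ 2 := (neg_sq _).symm
  generalize qFalling ((q₀ : ℚ) ^ 2) m = M at *
  rw [hq]
  generalize -(q₀ : ℚ) = x at *
  generalize (-1 : ℚ) ^ n = s at *
  generalize (-1 : ℚ) ^ m = t at *
  generalize (-1 : ℚ) ^ l = u at *
  have hfl := hf l
  have hfn := hf n
  field_simp
  rw [hm, one_mul]
  ring

/-- The exponent of `q` in the order of an orthogonal group. -/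
theorem orthogonal_exponent (n l m : ℕ) :
    ((n + (l + 2 * m)) / 2).choose 2 + ((n + (l + 2 * m) + 1) / 2).choose 2 =
      n * l / 2 + ((n / 2).choose 2 + ((n + 1) / 2).choose 2) +
        ((l / 2).choose 2 + ((l + 1) / 2).choose 2) + (m * n + m * l + 2 * m.choose 2) := by
  have hs (a : ℕ) : (a + 1).choose 2 = a + a.choose 2 := by
    rw [Nat.choose_succ_succ' a 1, Nat.choose_one_right]
  rcases Nat.even_or_odd' n with ⟨a, rfl | rfl⟩ <;> rcases Nat.even_or_odd' l with ⟨b, rfl | rfl⟩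
  · rw [show (2 * a + (2 * b + 2 * m)) / 2 = a + b + m by omega,
      show (2 * a + (2 * b + 2 * m) + 1) / 2 = a + b + m by omega,
      show 2 * a * (2 * b) / 2 = 2 * a * b by rw [mul_left_comm, Nat.mul_div_cancel_left _ two_pos],
      show 2 * a / 2 = a by omega, show 2 * b / 2 = b by omega, show (2 * a + 1) / 2 = a by omega,
      show (2 * b + 1) / 2 = b by omega, Nat.choose_two_add, Nat.choose_two_add]
    ring
  · rw [show (2 * a + (2 * b + 1 + 2 * m)) / 2 = a + b + m by omega,
      show (2 * a + (2 * b + 1 + 2 * m) + 1) / 2 = a + b + m + 1 by omega,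
      show 2 * a * (2 * b + 1) / 2 = a * (2 * b + 1) by
        rw [mul_assoc, Nat.mul_div_cancel_left _ two_pos],
      show 2 * a / 2 = a by omega, show (2 * a + 1) / 2 = a by omega,
      show (2 * b + 1) / 2 = b by omega, show (2 * b + 1 + 1) / 2 = b + 1 by omega, hs, hs,
      Nat.choose_two_add, Nat.choose_two_add]
    ring
  · rw [show (2 * a + 1 + (2 * b + 2 * m)) / 2 = a + b + m by omega,
      show (2 * a + 1 + (2 * b + 2 * m) + 1) / 2 = a + b + m + 1 by omega,
      show (2 * a + 1) * (2 * b) / 2 = (2 * a + 1) * b by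
        rw [mul_left_comm, Nat.mul_div_cancel_left _ two_pos],
      show 2 * b / 2 = b by omega, show (2 * a + 1) / 2 = a by omega,
      show (2 * b + 1) / 2 = b by omega, show (2 * a + 1 + 1) / 2 = a + 1 by omega, hs, hs,
      Nat.choose_two_add, Nat.choose_two_add]
    ring
  · rw [show (2 * a + 1 + (2 * b + 1 + 2 * m)) / 2 = a + b + m + 1 by omega,
      show (2 * a + 1 + (2 * b + 1 + 2 * m) + 1) / 2 = a + b + m + 1 by omega,
      show (2 * a + 1) * (2 * b + 1) / 2 = 2 * a * b + a + b by
        rw [show (2 * a + 1) * (2 * b + 1) = 2 * (2 * a * b + a + b) + 1 by ring]; omega,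
      show (2 * a + 1 + 1) / 2 = a + 1 by omega, show (2 * a + 1) / 2 = a by omega,
      show (2 * b + 1) / 2 = b by omega, show (2 * b + 1 + 1) / 2 = b + 1 by omega, hs, hs, hs,
      Nat.choose_two_add, Nat.choose_two_add]
    ring

/-- The inverse of e(r, χ) occurs on both sides and stays opaque, while e(l, ψ₂) lands in a
numerator. So only e(n, ψ₁) must be nonzero, and a complement of the empty type (0, -1) is allowed.
-/
theorem formulaQ_symmetric_mul {q₀ q : ℕ} (hq : 1 < q) {ε χ ψ₁ ψ₂ : ℤ} (n m l : ℕ)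
    (he : eFactor q ε n ψ₁ ≠ 0) :
    formulaQ symmetric q₀ q ε (n + (l + 2 * m)) χ n ψ₁ m l ψ₂ *
      (isomOrder symmetric q₀ q ε n ψ₁ * (q : ℚ) ^ (m * (1 * n)) *
        ((q : ℚ) ^ m.choose 2 * qFalling q m)) =
      isomOrder symmetric q₀ q ε (n + (l + 2 * m)) χ *
        (isomOrder symmetric q₀ q ε l ψ₂)⁻¹ / isoFrameStab symmetric q₀ q l m := by
  have h1 : (1 : ℚ) < q := by exact_mod_cast hq
  have hx : (q : ℚ) ≠ 0 := by positivity
  have hf := fun r => qFalling_ne_zero (x := (q : ℚ) ^ 2)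
    (by rw [abs_of_pos (by positivity)]; exact one_lt_pow₀ h1 two_ne_zero) r
  have hg : qFalling (q : ℚ) m ≠ 0 :=
    qFalling_ne_zero (by rwa [abs_of_pos (by positivity)]) m
  rw [formulaQ, if_neg (by omega)]
  simp only [isomOrder, isoFrameStab, Int.toNat_natCast, orthogonal_exponent, inv_div]
  have hfl := hf (l / 2)
  have hfn := hf (n / 2)
  rw [div_eq_mul_inv _ (eFactor q ε (n + (l + 2 * m)) χ),
    div_eq_mul_inv _ (eFactor q ε (n + (l + 2 * m)) χ)]
  generalize (eFactor q ε (n + (l + 2 * m)) χ)⁻¹ = E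
  field_simp
  ring

theorem formulaQ_alternating_mul {q₀ q : ℕ} (hq : 1 < q) (ε χ ψ₁ ψ₂ : ℤ) (n m l : ℕ) :
    formulaQ alternating q₀ q ε (n + (l + 1 * m)) χ n ψ₁ m l ψ₂ *
      (isomOrder alternating q₀ q ε n ψ₁ * (q : ℚ) ^ (m * (2 * n)) *
        ((q : ℚ) ^ m.choose 2 * qFalling q m)) =
      isomOrder alternating q₀ q ε (n + (l + 1 * m)) χ *
        (isomOrder alternating q₀ q ε l ψ₂)⁻¹ / isoFrameStab alternating q₀ q l m := by
  have h1 : (1 : ℚ) < q := by exact_mod_cast hq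
  have hx : (q : ℚ) ≠ 0 := by positivity
  have hf := fun r => qFalling_ne_zero (x := (q : ℚ) ^ 2)
    (by rw [abs_of_pos (by positivity)]; exact one_lt_pow₀ h1 two_ne_zero) r
  have hg : qFalling (q : ℚ) m ≠ 0 :=
    qFalling_ne_zero (by rwa [abs_of_pos (by positivity)]) m
  rw [formulaQ, if_neg (by omega)]
  have hm : m * m = m + 2 * m.choose 2 := by
    have h2 := Nat.choose_two_double m
    rw [two_mul m, Nat.choose_two_add] at h2
    omega
  have h3 : (n + (l + 1 * m)) ^ 2 = n ^ 2 + l ^ 2 + 2 * n * l + 2 * n * m + 2 * l * m +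
      (m + 2 * m.choose 2) := by rw [← hm]; ring
  simp only [isomOrder, isoFrameStab, Int.toNat_natCast, h3, Nat.choose_succ_succ' m 1,
    Nat.choose_one_right]
  have hfl := hf l
  have hfn := hf n
  field_simp
  ring

end FormCase
end Formula

/-! ### The theorem. -/

theorem mainTheorem6 {F₀ F V : Type*} [Field F₀] [Fintype F₀] [Field F] [Fintype F]
    [DecidableEq F] [Algebra F₀ F] [AddCommGroup V] [Module F V] [FiniteDimensional F V]
    (c : FormCase) (σ : F →+* F) (B : V →ₛₗ[σ] V →ₗ[F] F) (hB : c.IsForm F₀ σ B)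
    (r : ℕ) (χ : ℤ) (hV : c.HasType B r χ)
    (m n : ℕ) (hm : m ≤ r) (hn : n ≤ r) (ψ₁ : ℤ) (hψ₁ : ψ₁ ∈ c.Sign)
    (l : ℤ) (hl : l = r - n - (2 / c.gamma : ℕ) * m)
    (ψ₂ : ℤ) (hψ₂ : ψ₂ = χ * ψ₁ * c.sign F (-1) ^ m) :
    (Nat.card {N : Submodule F V // Module.finrank F (formRadical B N) = m ∧
        c.HasType (quotientForm B hB.isRefl N) n ψ₁} : ℚ) =
      formulaQ c (Fintype.card F₀) (Fintype.card F) (c.sign F (-1)) r χ n ψ₁ m l ψ₂ := by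
  have : Finite V := Module.finite_of_finite F
  have hq : 1 < Fintype.card F := Fintype.one_lt_card
  have hq₀ : 1 < Fintype.card F₀ := Fintype.one_lt_card
  have hε := FormCase.sign_neg_one_sq (F := F) c
  have hψ : ψ₁ ^ 2 = 1 := by
    cases c with
    | symmetric => rcases hψ₁ with rfl | rfl <;> norm_num
    | _ => obtain rfl : ψ₁ = 1 := hψ₁; norm_num
  by_cases h0 : n = 0 → ψ₁ = 1
  · have h0' : 0 < n ∨ ψ₁ = 1 := by
      rcases Nat.eq_zero_or_pos n with h | h
      · exact Or.inr (h0 h)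
      · exact Or.inl h
    obtain ⟨hcount, hzero⟩ := FormCase.card_typedSubspaces_mul (m := m) hB hn hV hψ₁ h0
    by_cases hl0 : l < 0
    · unfold formulaQ
      rw [if_pos hl0, Nat.cast_eq_zero]
      refine hzero ?_
      generalize 2 / c.gamma = t at hl ⊢
      zify
      linarith
    · obtain ⟨k, rfl⟩ := Int.eq_ofNat_of_zero_le (not_lt.1 hl0)
      obtain rfl : r = n + (k + 2 / c.gamma * m) := by
        generalize 2 / c.gamma = t at hl ⊢
        zify
        linarith
      have h1 : (0 : ℚ) < Fintype.card F := zero_lt_one.trans (FormCase.one_lt_cast_card F)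
      have hA : FormCase.formOrder F₀ F c n ψ₁ * (Fintype.card F : ℚ) ^ (m * (c.gamma * n)) *
          ((Fintype.card F : ℚ) ^ m.choose 2 * qFalling (Fintype.card F) m) ≠ 0 :=
        mul_ne_zero (mul_ne_zero (isomOrder_ne_zero c hq₀ hq hε hψ h0') (pow_ne_zero _ h1.ne'))
          (mul_ne_zero (pow_ne_zero _ h1.ne') (qFalling_ne_zero
            (by rw [abs_of_pos h1]; exact FormCase.one_lt_cast_card F) _))
      -- The two sides are compared after multiplication by the number of mixed frames per subspace.
      refine mul_right_cancel₀ hA ((hcount k rfl).trans ?_)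
      rw [hψ₂]
      cases c with
      | hermitian =>
        rw [FormCase.formOrder, FormCase.formOrder, FormCase.formOrder, hB.card_eq_sq rfl]
        exact (FormCase.formulaQ_hermitian_mul hq₀ _ _ _ _ n m k).symm
      | symmetric => exact (FormCase.formulaQ_symmetric_mul hq n m k
          (eFactor_ne_zero hq hε hψ h0')).symm
      | alternating => exact (FormCase.formulaQ_alternating_mul hq _ _ _ _ n m k).symm
  -- Type (0, -1): no quotient has it, and e(0, -1) = 0 makes the formula vanish.
  · push Not at h0
    obtain ⟨rfl, h0⟩ := h0
    have hempty : IsEmpty {N : Submodule F V // Module.finrank F (formRadical B N) = m ∧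
        c.HasType (quotientForm B hB.isRefl N) 0 ψ₁} := ⟨fun N => h0 N.2.2.eq_one_of_zero⟩
    rw [Nat.card_of_isEmpty, Nat.cast_zero]
    unfold formulaQ
    cases c with
    | symmetric =>
      obtain rfl : ψ₁ = -1 := hψ₁.resolve_left h0
      simp [eFactor]
    | _ => exact absurd hψ₁ h0
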